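/- Let $e$ be a Hermite–Biehler function, i.e. an entire function with $|e(z)|>|e(\bar z)|$ whenever $\operatorname{Im} z>0$, write $f^\#(z)=\overline{f(\bar z)}$, and let $\mathcal B=\mathcal B(e)$ be the de Branges space of all entire functions $f$ such that $f/e$ and $f^\#/e$ belong to the Hardy space $H_2$ of the upper half-plane, with inner product $$\langle g,f\rangle_{\mathcal B}=\int_{\mathbb R}\frac{\overline{g(x)}f(x)}{|e(x)|^2}\,dx .$$ Let $S$ be the operator of multiplication by the independent variable in $\mathcal B$, with domain $\{f\in\mathcal B: zf(z)\in\mathcal B\}$, and for $\beta\in[0,\pi)$ put $$s_\beta(z)=\tfrac i2\left[e^{i\beta}e(z)-e^{-i\beta}e^\#(z)\right].$$ Assume $s_0\in\mathcal B$ (this is the case where $S$ is not densely defined, suitably normalized). For $\beta\in(0,\pi)$ let $S_\beta$ be the linear operator in $\mathcal B$ given by $$\operatorname{dom}(S_\beta)=\left\{g(z)=\frac{s_\beta(w)f(z)-s_\beta(z)f(w)}{\sin\beta\,(z-w)} : f\in\mathcal B,\ w\in\mathbb C\right\},\qquad (S_\beta g)(z)=zg(z)+\frac{1}{\sin\beta}f(w)s_\beta(z).$$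 Then these operators are well defined; the set of canonical selfadjoint operator extensions of $S$ (the selfadjoint linear operators in $\mathcal B$ that extend $S$) is exactly $\{S_\beta:\beta\in(0,\pi)\}$; and for every $\beta\in(0,\pi)$ one has $\operatorname{dom}(S_\beta)=\operatorname{dom}(S_{\pi/2})$ and $$S_\beta=S_{\pi/2}-\frac{\cot\beta}{\pi}\,\langle s_0,\cdot\,\rangle_{\mathcal B}\,s_0 .$$ -/

import Mathlib

open Complex MeasureTheory Filter Topology Set
open scoped ENNReal ComplexConjugate

noncomputable section

/-- A Hermite-Biehler function: an entire function `e` with `|e(z)| > |e(conj z)|` for all `z` in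
the open upper half-plane. -/
structure HermiteBiehler where
  toFun : ℂ → ℂ
  differentiable' : Differentiable ℂ toFun
  norm_conj_lt' : ∀ z : ℂ, 0 < z.im → ‖toFun (conj z)‖ < ‖toFun z‖

instance : CoeFun HermiteBiehler (fun _ => ℂ → ℂ) := ⟨HermiteBiehler.toFun⟩

/-- `f^#(z) = conj (f (conj z))`. -/
def sharp (f : ℂ → ℂ) : ℂ → ℂ := fun z => conj (f (conj z))

/-- The Hardy space `H_2` of the open upper half-plane. -/
def MemHardyTwo (F : ℂ → ℂ) : Prop :=
  DifferentiableOn ℂ F {z : ℂ | 0 < z.im} ∧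
    (⨆ (y : ℝ) (_ : 0 < y), ∫⁻ x : ℝ, ‖F (x + y * I)‖ₑ ^ 2) < ∞

theorem MemHardyTwo.zero : MemHardyTwo (fun _ => 0) := by
  refine ⟨differentiableOn_const _, ?_⟩
  simp

theorem MemHardyTwo.measurable_line {F : ℂ → ℂ} (hF : MemHardyTwo F) {y : ℝ} (hy : 0 < y) :
    Measurable (fun x : ℝ => F (x + y * I)) := by
  have h : Continuous (fun x : ℝ => F (x + y * I)) := by
    refine hF.1.continuousOn.comp_continuous (by fun_prop) ?_
    intro x
    simpa using hy
  exact h.measurable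

theorem enorm_add_sq_le (a b : ℂ) : ‖a + b‖ₑ ^ 2 ≤ 2 * ‖a‖ₑ ^ 2 + 2 * ‖b‖ₑ ^ 2 := by
  have h : ‖a + b‖₊ ^ 2 ≤ 2 * ‖a‖₊ ^ 2 + 2 * ‖b‖₊ ^ 2 := by
    rw [← NNReal.coe_le_coe]
    push_cast
    nlinarith [norm_add_le a b, norm_nonneg (a + b), norm_nonneg a, norm_nonneg b,
      sq_nonneg (‖a‖ - ‖b‖)]
  simp only [enorm_eq_nnnorm]
  exact_mod_cast h

theorem MemHardyTwo.add {F G : ℂ → ℂ} (hF : MemHardyTwo F) (hG : MemHardyTwo G) :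
    MemHardyTwo (fun z => F z + G z) := by
  refine ⟨hF.1.add hG.1, ?_⟩
  refine lt_of_le_of_lt (b := 2 * (⨆ (y : ℝ) (_ : 0 < y), ∫⁻ x : ℝ, ‖F (x + y * I)‖ₑ ^ 2) +
    2 * (⨆ (y : ℝ) (_ : 0 < y), ∫⁻ x : ℝ, ‖G (x + y * I)‖ₑ ^ 2)) ?_ ?_
  · refine iSup₂_le fun y hy => ?_
    have mF := (hF.measurable_line hy).enorm.pow_const 2
    have mG := (hG.measurable_line hy).enorm.pow_const 2
    calc ∫⁻ x : ℝ, ‖F (x + y * I) + G (x + y * I)‖ₑ ^ 2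
        ≤ ∫⁻ x : ℝ, (2 * ‖F (x + y * I)‖ₑ ^ 2 + 2 * ‖G (x + y * I)‖ₑ ^ 2) :=
          lintegral_mono fun x => enorm_add_sq_le _ _
      _ = 2 * (∫⁻ x : ℝ, ‖F (x + y * I)‖ₑ ^ 2) + 2 * ∫⁻ x : ℝ, ‖G (x + y * I)‖ₑ ^ 2 := by
          rw [lintegral_add_left (mF.const_mul 2), lintegral_const_mul 2 mF,
            lintegral_const_mul 2 mG]
      _ ≤ _ := by
          gcongr
          · exact le_iSup₂ (f := fun (y : ℝ) (_ : 0 < y) => ∫⁻ x : ℝ, ‖F (x + y * I)‖ₑ ^ 2) y hy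
          · exact le_iSup₂ (f := fun (y : ℝ) (_ : 0 < y) => ∫⁻ x : ℝ, ‖G (x + y * I)‖ₑ ^ 2) y hy
  · exact ENNReal.add_lt_top.2 ⟨ENNReal.mul_lt_top (by simp) hF.2,
      ENNReal.mul_lt_top (by simp) hG.2⟩

theorem MemHardyTwo.const_mul {F : ℂ → ℂ} (hF : MemHardyTwo F) (c : ℂ) :
    MemHardyTwo (fun z => c * F z) := by
  refine ⟨hF.1.const_mul c, ?_⟩
  refine lt_of_le_of_lt
    (b := ‖c‖ₑ ^ 2 * (⨆ (y : ℝ) (_ : 0 < y), ∫⁻ x : ℝ, ‖F (x + y * I)‖ₑ ^ 2)) ?_ ?_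
  · refine iSup₂_le fun y hy => ?_
    have mF := (hF.measurable_line hy).enorm.pow_const 2
    simp only [enorm_mul, mul_pow]
    rw [lintegral_const_mul _ mF]
    gcongr
    exact le_iSup₂ (f := fun (y : ℝ) (_ : 0 < y) => ∫⁻ x : ℝ, ‖F (x + y * I)‖ₑ ^ 2) y hy
  · exact ENNReal.mul_lt_top (by simp) hF.2

namespace HermiteBiehler

variable (e : HermiteBiehler)

/-- The linear space of entire functions `f` with `f / e` and `f^# / e` in `H_2`. -/
def carrier : Submodule ℂ (ℂ → ℂ) where
  carrier := {f | Differentiable ℂ f ∧ MemHardyTwo (fun z => f z / e z) ∧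
    MemHardyTwo (fun z => sharp f z / e z)}
  zero_mem' := by
    refine ⟨differentiable_const _, ?_, ?_⟩
    · simpa using MemHardyTwo.zero
    · simpa [sharp] using MemHardyTwo.zero
  add_mem' := by
    rintro f g ⟨hf, hf1, hf2⟩ ⟨hg, hg1, hg2⟩
    refine ⟨hf.add hg, ?_, ?_⟩
    · simpa [add_div] using hf1.add hg1
    · simpa [sharp, add_div] using hf2.add hg2
  smul_mem' := by
    rintro c f ⟨hf, hf1, hf2⟩
    refine ⟨hf.const_smul c, ?_, ?_⟩
    · simpa [mul_div_assoc] using hf1.const_mul c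
    · simpa [sharp, mul_div_assoc] using hf2.const_mul (conj c)

/-- The de Branges space `B(e)`, as a type.  It carries the topology of the inner product below
(and not that of pointwise convergence). -/
def Space : Type := e.carrier

instance : AddCommGroup e.Space := inferInstanceAs (AddCommGroup e.carrier)

instance : Module ℂ e.Space := inferInstanceAs (Module ℂ e.carrier)

variable {e}

/-- The entire function underlying an element of `B(e)`. -/
def Space.toFun (f : e.Space) : ℂ → ℂ := (show e.carrier from f).1

instance : CoeFun e.Space (fun _ => ℂ → ℂ) := ⟨Space.toFun⟩

/-- The element of `B(e)` given by a function that belongs to it. -/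
def Space.mk (f : ℂ → ℂ) (hf : f ∈ e.carrier) : e.Space := (⟨f, hf⟩ : e.carrier)

theorem Space.mem (f : e.Space) : (f : ℂ → ℂ) ∈ e.carrier := (show e.carrier from f).2

@[ext]
theorem Space.ext {f g : e.Space} (h : ∀ z, f z = g z) : f = g :=
  Subtype.ext (funext h)

@[simp] theorem Space.mk_apply (f : ℂ → ℂ) (hf : f ∈ e.carrier) (z : ℂ) :
    (Space.mk f hf : e.Space) z = f z := rfl

@[simp] theorem Space.add_apply (f g : e.Space) (z : ℂ) : (f + g) z = f z + g z := rfl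

@[simp] theorem Space.smul_apply (c : ℂ) (f : e.Space) (z : ℂ) : (c • f) z = c * f z := rfl

@[simp] theorem Space.zero_apply (z : ℂ) : (0 : e.Space) z = 0 := rfl

theorem Space.memLp (f : e.Space) :
    MemLp (fun x : ℝ => f x / e x) 2 (volume : Measure ℝ) := by
  obtain ⟨hfd, hfH, -⟩ := f.mem
  have hf := hfd.continuous
  have he := e.differentiable'.continuous
  have hm : Measurable (fun x : ℝ => f x / e x) :=
    (hf.comp continuous_ofReal).measurable.div (he.comp continuous_ofReal).measurable
  refine ⟨hm.aestronglyMeasurable, ?_⟩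
  rw [eLpNorm_lt_top_iff_lintegral_rpow_enorm_lt_top (by norm_num) (by norm_num)]
  simp only [ENNReal.toReal_ofNat, ENNReal.rpow_ofNat]
  set y : ℕ → ℝ := fun n => 1 / ((n : ℝ) + 1) with hy
  have hy0 : ∀ n, 0 < y n := fun n => by positivity
  have hyt : Tendsto y atTop (𝓝 0) := tendsto_one_div_add_atTop_nhds_zero_nat
  have hpt : ∀ x : ℝ, ‖f x / e x‖ₑ ^ 2 ≤
      liminf (fun n => ‖f (x + y n * I) / e (x + y n * I)‖ₑ ^ 2) atTop := by
    intro x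
    by_cases hx : e x = 0
    · simp [hx]
    · have hz : Tendsto (fun n => (x : ℂ) + y n * I) atTop (𝓝 (x : ℂ)) := by
        have h1 : Tendsto (fun n => (y n : ℂ)) atTop (𝓝 ((0 : ℝ) : ℂ)) :=
          (continuous_ofReal.tendsto 0).comp hyt
        simpa using (h1.mul_const I).const_add (x : ℂ)
      have h2 : Tendsto (fun n => f (x + y n * I) / e (x + y n * I)) atTop (𝓝 (f x / e x)) :=
        ((hf.tendsto _).comp hz).div ((he.tendsto _).comp hz) hx
      have h3 : Tendsto (fun n => ‖f (x + y n * I) / e (x + y n * I)‖ₑ ^ 2) atTop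
          (𝓝 (‖f x / e x‖ₑ ^ 2)) := ENNReal.Tendsto.pow h2.enorm
      exact h3.liminf_eq.ge
  calc ∫⁻ x : ℝ, ‖f x / e x‖ₑ ^ 2
      ≤ ∫⁻ x : ℝ, liminf (fun n => ‖f (x + y n * I) / e (x + y n * I)‖ₑ ^ 2) atTop :=
        lintegral_mono hpt
    _ ≤ liminf (fun n => ∫⁻ x : ℝ, ‖f (x + y n * I) / e (x + y n * I)‖ₑ ^ 2) atTop :=
        lintegral_liminf_le fun n => (hfH.measurable_line (hy0 n)).enorm.pow_const 2
    _ ≤ ⨆ (y : ℝ) (_ : 0 < y), ∫⁻ x : ℝ, ‖f (x + y * I) / e (x + y * I)‖ₑ ^ 2 := by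
        refine liminf_le_of_le (by isBoundedDefault) fun b hb => ?_
        obtain ⟨n, hn⟩ := hb.exists
        exact hn.trans (le_iSup₂ (f := fun (y : ℝ) (_ : 0 < y) =>
          ∫⁻ x : ℝ, ‖f (x + y * I) / e (x + y * I)‖ₑ ^ 2) (y n) (hy0 n))
    _ < ∞ := hfH.2

theorem integrand_eq (g f : e.Space) (x : ℝ) :
    conj (g x) * f x / (‖e x‖ : ℂ) ^ 2 = conj (g x / e x) * (f x / e x) := by
  rw [← Complex.conj_mul', map_div₀]
  ring

theorem integrable_integrand (g f : e.Space) :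
    Integrable (fun x : ℝ => conj (g x) * f x / (‖e x‖ : ℂ) ^ 2) := by
  simp only [integrand_eq]
  exact MemLp.integrable_mul (p := 2) (q := 2) g.memLp.star f.memLp

theorem eq_zero_of_real {f : e.Space} (h : ∀ x : ℝ, f x * e x = 0) : f = 0 := by
  have hfa : AnalyticOnNhd ℂ f univ := f.mem.1.differentiableOn.analyticOnNhd isOpen_univ
  have hea : AnalyticOnNhd ℂ e univ := e.differentiable'.differentiableOn.analyticOnNhd isOpen_univ
  have hprod : (fun z => f z * e z) = fun _ => 0 := by
    refine (hfa.mul hea).eq_of_frequently_eq (z₀ := 0) analyticOnNhd_const ?_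
    have ht : Tendsto (fun n : ℕ => ((1 / ((n : ℝ) + 1) : ℝ) : ℂ)) atTop (𝓝[≠] 0) := by
      refine tendsto_nhdsWithin_iff.2 ⟨?_, Eventually.of_forall fun n => ?_⟩
      · exact (continuous_ofReal.tendsto 0).comp
          (tendsto_one_div_add_atTop_nhds_zero_nat (𝕜 := ℝ))
      · have : (1 / ((n : ℝ) + 1) : ℝ) ≠ 0 := by positivity
        simpa only [mem_compl_iff, mem_singleton_iff, ofReal_eq_zero] using this
    exact ht.frequently (Frequently.of_forall fun n => h _)
  have hup : ∀ z : ℂ, 0 < z.im → f z = 0 := by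
    intro z hz
    have hez : e z ≠ 0 := fun h0 => by
      have := e.norm_conj_lt' z hz
      rw [h0, norm_zero] at this
      exact absurd this (not_lt.2 (norm_nonneg _))
    exact (mul_eq_zero.1 (congrFun hprod z)).resolve_right hez
  have hfz : (f : ℂ → ℂ) = fun _ => 0 := by
    refine hfa.eq_of_eventuallyEq (z₀ := I) analyticOnNhd_const ?_
    have : {z : ℂ | 0 < z.im} ∈ 𝓝 I :=
      (isOpen_lt continuous_const continuous_im).mem_nhds (by simp)
    filter_upwards [this] with z hz using hup z hz
  exact Space.ext fun z => congrFun hfz z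

variable (e)

/-- The inner product `⟪g, f⟫ = ∫ conj (g x) * f x / |e x|² dx` of `B(e)`. -/
abbrev core : InnerProductSpace.Core ℂ e.Space where
  inner g f := ∫ x : ℝ, conj (g x) * f x / (‖e x‖ : ℂ) ^ 2
  conj_inner_symm g f := by
    rw [← integral_conj]
    congr 1
    funext x
    simp [mul_comm]
  re_inner_nonneg f := by
    have : (fun x : ℝ => conj (f x) * f x / (‖e x‖ : ℂ) ^ 2) =
        fun x : ℝ => ((‖f x / e x‖ ^ 2 : ℝ) : ℂ) := by
      funext x
      rw [integrand_eq, Complex.conj_mul']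
      push_cast
      rfl
    rw [this, integral_complex_ofReal]
    exact integral_nonneg fun x : ℝ => sq_nonneg ‖f x / e x‖
  add_left f g h := by
    rw [← integral_add (integrable_integrand f h) (integrable_integrand g h)]
    congr 1
    funext x
    simp only [Space.add_apply, map_add]
    ring
  smul_left f g c := by
    rw [← integral_const_mul]
    congr 1
    funext x
    simp only [Space.smul_apply, map_mul]
    ring
  definite f hf := by
    have heq : (fun x : ℝ => conj (f x) * f x / (‖e x‖ : ℂ) ^ 2) =
        fun x : ℝ => ((‖f x / e x‖ ^ 2 : ℝ) : ℂ) := by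
      funext x
      rw [integrand_eq, Complex.conj_mul']
      push_cast
      rfl
    have hint : Integrable (fun x : ℝ => ‖f x / e x‖ ^ 2) := by
      simpa using f.memLp.integrable_norm_pow (by norm_num)
    change ∫ x : ℝ, conj (f x) * f x / (‖e x‖ : ℂ) ^ 2 = 0 at hf
    rw [heq, integral_complex_ofReal, ofReal_eq_zero,
      integral_eq_zero_iff_of_nonneg (fun x => sq_nonneg _) hint] at hf
    have hae : (fun x : ℝ => f x * e x) =ᵐ[volume] fun _ => 0 := by
      filter_upwards [hf] with x hx
      have : f x / e x = 0 := by simpa using hx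
      rcases div_eq_zero_iff.1 this with h | h <;> simp [h]
    have hc : Continuous (fun x : ℝ => f x * e x) :=
      (f.mem.1.continuous.comp continuous_ofReal).mul
        (e.differentiable'.continuous.comp continuous_ofReal)
    have := (hc.ae_eq_iff_eq volume continuous_const).1 hae
    exact eq_zero_of_real fun x => congrFun this x

instance : NormedAddCommGroup e.Space :=
  @InnerProductSpace.Core.toNormedAddCommGroup ℂ e.Space _ _ _ e.core

instance : InnerProductSpace ℂ e.Space := InnerProductSpace.ofCore e.core.toCore

theorem inner_def (g f : e.Space) :
    inner ℂ g f = ∫ x : ℝ, conj (g x) * f x / (‖e x‖ : ℂ) ^ 2 := rfl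

/-- The operator `S` of multiplication by the independent variable, with its maximal domain
`{f ∈ B(e) | z f(z) ∈ B(e)}`. -/
def mulOp : e.Space →ₗ.[ℂ] e.Space where
  domain :=
    { carrier := {f | (fun z => z * f z) ∈ e.carrier}
      zero_mem' := by
        have h : (fun z => z * (0 : e.Space) z) = (0 : ℂ → ℂ) := by
          funext z
          simp
        change (fun z => z * (0 : e.Space) z) ∈ e.carrier
        rw [h]
        exact e.carrier.zero_mem
      add_mem' := by
        intro f g hf hg
        have h : (fun z => z * (f + g) z) = (fun z => z * f z) + fun z => z * g z := by
          funext z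
          simp [mul_add]
        change (fun z => z * (f + g) z) ∈ e.carrier
        rw [h]
        exact e.carrier.add_mem hf hg
      smul_mem' := by
        intro c f hf
        have h : (fun z => z * (c • f) z) = c • fun z => z * f z := by
          funext z
          simp [mul_left_comm]
        change (fun z => z * (c • f) z) ∈ e.carrier
        rw [h]
        exact e.carrier.smul_mem c hf }
  toFun :=
    { toFun := fun f => Space.mk (fun z => z * f.1 z) f.2
      map_add' := by
        intro f g
        ext z
        simp [mul_add]
      map_smul' := by
        intro c f
        ext z
        simp [mul_left_comm] }

/-- The associated functions
`s_β(z) = (i/2) (exp(iβ) e(z) - exp(-iβ) e^#(z))`. -/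
def s (β : ℝ) : ℂ → ℂ :=
  fun z => I / 2 * (exp (I * β) * e z - exp (-(I * β)) * sharp e z)

/-- `g` is the entire function
`g(z) = (s_β(w) f(z) - s_β(z) f(w)) / (sin β (z - w))`
(with its removable singularity at `z = w` removed). -/
def IsQuotient (β : ℝ) (w : ℂ) (f g : ℂ → ℂ) : Prop :=
  Differentiable ℂ g ∧
    ∀ z, z ≠ w → g z = (e.s β w * f z - e.s β z * f w) / (Real.sin β * (z - w))

/-- `T` is the operator `S_β` (for `β ∈ (0, π)`): its domain consists of all functions
`g(z) = (s_β(w) f(z) - s_β(z) f(w)) / (sin β (z - w))`, `f ∈ B(e)`, `w ∈ ℂ`, and on them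
`(T g)(z) = z g(z) + f(w) s_β(z) / sin β`.  These conditions determine `T`. -/
structure IsExtensionOp (β : ℝ) (T : e.Space →ₗ.[ℂ] e.Space) : Prop where
  domain_eq : ∀ g : ℂ → ℂ,
    (∃ x : T.domain, ((x : e.Space) : ℂ → ℂ) = g) ↔
      ∃ (f : e.Space) (w : ℂ), e.IsQuotient β w f g
  apply_eq : ∀ (x : T.domain) (f : e.Space) (w : ℂ), e.IsQuotient β w f (x : e.Space) →
    ∀ z, (T x) z = z * (x : e.Space) z + 1 / (Real.sin β : ℂ) * f w * e.s β z

/-- `T` is a selfadjoint operator in `B(e)`: it is densely defined, and its graph equals the graph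
of its adjoint, that is, `(y, y')` is in the graph of `T` iff
`⟪T x, y⟫ = ⟪x, y'⟫` for all `x` in the domain of `T`. -/
def IsSelfadjointOp (T : e.Space →ₗ.[ℂ] e.Space) : Prop :=
  Dense (T.domain : Set e.Space) ∧ T.graph.adjoint = T.graph

end HermiteBiehler

end

/-!
Put `s = s_{π/2}`, so that `s_β / sin β = s + t s_0` with `t = cot β`, and `e = -s - i s_0`.

*The operators.* If `s_0 ∈ B(e)`, the domain of `S_β` consists of all `g ∈ B(e)` for which
`z g + c s ∈ B(e)` for some number `c`, and `S_β g = z g + c (s + t s_0)`. The whole argument rests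
on two facts about such pairs `(g, c)`: the number `c` is determined by `g` through
`⟪s_0, g⟫ = -π c` (`inner_s_zero`), and `S_{π/2}` is symmetric (`inner_mul_add_assoc`). Together
they give at once the formula for `S_β - S_{π/2}` and the symmetry of all the `S_β`.

*The two facts.* Since `s / e = -1 - i s_0 / e` and `s_0 / e ∈ H_2`, one has `z g / e = c + k` with
`k ∈ H_2`, so that `g / e` is asymptotic to `c / z` along the imaginary axis. On the real line the
integrands are combinations of `g / e` and `g / e^#`. These need not be absolutely integrable, so
the integrals are regularized by the factor `R i / (x + R i)`, with `R → ∞`. The first then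
integrates to `0` by Cauchy's theorem in `H_2`, the second to `2 π` times the conjugate of
`R (g^# / e)(R i)`, by Cauchy's formula (`tendsto_regularized_integral`). What is needed from the
theory of `H_2` is thus only Cauchy's theorem and Cauchy's formula for poles at `∓ R i`, obtained
from rectangles and from the weak convergence in `L²` of `F(x + i y)` to the boundary values of `F`,
and the estimate `F(R i) = o(R ^ (-1/2))`.

*Selfadjointness.* The quotients in the definition of `dom S_β` belong to `B(e)` (`quotient_mem`),
which says that `S_β - w` is onto for nonreal `w`. The domain is dense, since
`-R i (S_{π/2} - R i)⁻¹ f` tends to `f` (`dense_domain_extOp`). A symmetric densely defined operator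
for which `S_β ± i` are onto is selfadjoint; completeness of `B(e)` plays no role.

*Classification.* `S` is the restriction of `S_{π/2}` to the kernel of `c`. Hence its adjoint
relation consists of the pairs `(y, S_{π/2} y + d s_0)` with `d` a number
(`exists_eq_extOp_add_of_adjoint`). A selfadjoint extension `T` is contained in this relation, its
symmetry makes `d` a real multiple of `c(y)`, and so `T` is contained in some `S_β`. Both being
selfadjoint, they are equal.
-/

open Complex MeasureTheory Filter Topology Set
open scoped ENNReal ComplexConjugate

noncomputable section

/-! ### The kernels of Cauchy's formula on the real line -/

theorem integrable_inv_sq_add_sq {R : ℝ} (hR : 0 < R) :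
    Integrable (fun x : ℝ => (x ^ 2 + R ^ 2)⁻¹) := by
  have h := (integrable_inv_one_add_sq.comp_div (g := fun x : ℝ => (1 + x ^ 2)⁻¹) hR.ne').const_mul
    (R ^ 2)⁻¹
  refine h.congr (Eventually.of_forall fun x => ?_)
  simp only
  rw [← mul_inv]
  congr 1
  field_simp
  ring

theorem integral_univ_inv_sq_add_sq {R : ℝ} (hR : 0 < R) :
    ∫ x : ℝ, (x ^ 2 + R ^ 2)⁻¹ = Real.pi / R := by
  have h := Measure.integral_comp_div (fun x : ℝ => (1 + x ^ 2)⁻¹) R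
  rw [integral_univ_inv_one_add_sq, abs_of_pos hR, smul_eq_mul] at h
  have h2 : (fun x : ℝ => (x ^ 2 + R ^ 2)⁻¹) = fun x => (R ^ 2)⁻¹ * (1 + (x / R) ^ 2)⁻¹ := by
    funext x
    rw [← mul_inv]
    congr 1
    field_simp
    ring
  rw [h2, integral_const_mul, h]
  field_simp

theorem norm_ofReal_add_mul_I_sq (x R : ℝ) : ‖(x : ℂ) + R * I‖ ^ 2 = x ^ 2 + R ^ 2 := by
  rw [← Complex.normSq_eq_norm_sq, Complex.normSq_add_mul_I]

theorem norm_ofReal_sub_mul_I_sq (x R : ℝ) : ‖(x : ℂ) - R * I‖ ^ 2 = x ^ 2 + R ^ 2 := by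
  have := norm_ofReal_add_mul_I_sq x (-R)
  simpa [sub_eq_add_neg] using this

theorem ofReal_add_mul_I_ne_zero (x : ℝ) {R : ℝ} (hR : R ≠ 0) : (x : ℂ) + R * I ≠ 0 := by
  intro h
  have := norm_ofReal_add_mul_I_sq x R
  rw [h] at this
  have h2 : 0 < R ^ 2 := by positivity
  norm_num at this
  nlinarith [sq_nonneg x]

theorem ofReal_sub_mul_I_ne_zero (x : ℝ) {R : ℝ} (hR : R ≠ 0) : (x : ℂ) - R * I ≠ 0 := by
  have := ofReal_add_mul_I_ne_zero x (neg_ne_zero.2 hR)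
  simpa [sub_eq_add_neg] using this

theorem lintegral_enorm_inv_add_mul_I {R : ℝ} (hR : 0 < R) :
    ∫⁻ x : ℝ, ‖((x : ℂ) + R * I)⁻¹‖ₑ ^ 2 = ENNReal.ofReal (Real.pi / R) := by
  rw [← integral_univ_inv_sq_add_sq hR,
    ofReal_integral_eq_lintegral_ofReal (integrable_inv_sq_add_sq hR)
      (Eventually.of_forall fun x => by positivity)]
  congr 1
  funext x
  rw [← norm_ofReal_add_mul_I_sq, ← ofReal_norm, ← ENNReal.ofReal_pow (norm_nonneg _), norm_inv,
    inv_pow]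

theorem memLp_two_of_lintegral {a : ℝ → ℂ} (hm : AEStronglyMeasurable a volume)
    (h : ∫⁻ x, ‖a x‖ₑ ^ 2 < ∞) : MemLp a 2 volume := by
  refine ⟨hm, ?_⟩
  rw [eLpNorm_lt_top_iff_lintegral_rpow_enorm_lt_top (by norm_num) (by norm_num)]
  simpa using h

theorem lintegral_lt_top_of_memLp_two {a : ℝ → ℂ} (h : MemLp a 2 volume) :
    ∫⁻ x, ‖a x‖ₑ ^ 2 < ∞ := by
  have := h.2
  rw [eLpNorm_lt_top_iff_lintegral_rpow_enorm_lt_top (by norm_num) (by norm_num)] at this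
  simpa using this

theorem integrable_mul_of_memLp_two {a b : ℝ → ℂ} (ha : MemLp a 2 volume)
    (hb : MemLp b 2 volume) : Integrable (fun x => a x * b x) :=
  MemLp.integrable_mul (p := 2) (q := 2) ha hb

theorem memLp_inv_add_mul_I {R : ℝ} (hR : R ≠ 0) :
    MemLp (fun x : ℝ => ((x : ℂ) + R * I)⁻¹) 2 volume := by
  have hc : Continuous (fun x : ℝ => ((x : ℂ) + R * I)⁻¹) :=
    Continuous.inv₀ (by fun_prop) fun x => ofReal_add_mul_I_ne_zero x hR
  refine memLp_two_of_lintegral hc.aestronglyMeasurable ?_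
  have h : ∀ x : ℝ, ‖((x : ℂ) + R * I)⁻¹‖ₑ ^ 2 = ‖((x : ℂ) + (|R| : ℝ) * I)⁻¹‖ₑ ^ 2 := by
    intro x
    rw [← ofReal_norm, ← ofReal_norm, ← ENNReal.ofReal_pow (norm_nonneg _),
      ← ENNReal.ofReal_pow (norm_nonneg _), norm_inv, norm_inv, inv_pow, inv_pow,
      norm_ofReal_add_mul_I_sq, norm_ofReal_add_mul_I_sq, sq_abs]
  simp only [h]
  rw [lintegral_enorm_inv_add_mul_I (abs_pos.2 hR)]
  exact ENNReal.ofReal_lt_top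

theorem memLp_inv_sub_mul_I {R : ℝ} (hR : R ≠ 0) :
    MemLp (fun x : ℝ => ((x : ℂ) - R * I)⁻¹) 2 volume := by
  simpa [sub_eq_add_neg] using memLp_inv_add_mul_I (neg_ne_zero.2 hR)

/-! ### The Hardy space of the upper half-plane -/

theorem memHardyTwo_inv_add_mul_I {R : ℝ} (hR : 0 < R) :
    MemHardyTwo (fun z => (z + R * I)⁻¹) := by
  refine ⟨?_, ?_⟩
  · intro z hz
    refine DifferentiableAt.differentiableWithinAt ?_
    refine DifferentiableAt.inv (by fun_prop) fun h => ?_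
    have := congrArg im h
    simp at this
    have hz' : 0 < z.im := hz
    linarith
  · refine lt_of_le_of_lt (b := ENNReal.ofReal (Real.pi / R)) ?_ ENNReal.ofReal_lt_top
    refine iSup₂_le fun y hy => ?_
    have h : ∀ x : ℝ, (x : ℂ) + y * I + R * I = x + ((y + R : ℝ) : ℂ) * I := by
      intro x
      push_cast
      ring
    simp only [h]
    rw [lintegral_enorm_inv_add_mul_I (by linarith)]
    gcongr
    linarith

/-- An analytic function on the upper half-plane that is dominated by a sum of two functions of
`H_2` belongs to `H_2`. -/
theorem MemHardyTwo.of_norm_le {F G H : ℂ → ℂ} (hG : MemHardyTwo G) (hH : MemHardyTwo H)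
    (hF : DifferentiableOn ℂ F {z : ℂ | 0 < z.im})
    (h : ∀ z : ℂ, 0 < z.im → ‖F z‖ ≤ ‖G z‖ + ‖H z‖) : MemHardyTwo F := by
  refine ⟨hF, ?_⟩
  refine lt_of_le_of_lt (b := 2 * (⨆ (y : ℝ) (_ : 0 < y), ∫⁻ x : ℝ, ‖G (x + y * I)‖ₑ ^ 2) +
    2 * (⨆ (y : ℝ) (_ : 0 < y), ∫⁻ x : ℝ, ‖H (x + y * I)‖ₑ ^ 2)) ?_ ?_
  · refine iSup₂_le fun y hy => ?_
    have mG := (hG.measurable_line hy).enorm.pow_const 2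
    have mH := (hH.measurable_line hy).enorm.pow_const 2
    calc ∫⁻ x : ℝ, ‖F (x + y * I)‖ₑ ^ 2
        ≤ ∫⁻ x : ℝ, (2 * ‖G (x + y * I)‖ₑ ^ 2 + 2 * ‖H (x + y * I)‖ₑ ^ 2) := by
          refine lintegral_mono fun x => ?_
          have h1 := h (x + y * I) (by simpa using hy)
          have h2 := enorm_add_sq_le (‖G (x + y * I)‖ : ℂ) (‖H (x + y * I)‖ : ℂ)
          have e1 : ‖(‖G (x + y * I)‖ : ℂ)‖ₑ = ‖G (x + y * I)‖ₑ := by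
            rw [← ofReal_norm, ← ofReal_norm]; simp
          have e2 : ‖(‖H (x + y * I)‖ : ℂ)‖ₑ = ‖H (x + y * I)‖ₑ := by
            rw [← ofReal_norm, ← ofReal_norm]; simp
          rw [e1, e2] at h2
          refine le_trans ?_ h2
          gcongr
          rw [enorm_le_iff_norm_le, ← ofReal_add, norm_real]
          exact h1.trans (le_abs_self _)
      _ = 2 * (∫⁻ x : ℝ, ‖G (x + y * I)‖ₑ ^ 2) + 2 * ∫⁻ x : ℝ, ‖H (x + y * I)‖ₑ ^ 2 := by
          rw [lintegral_add_left (mG.const_mul 2), lintegral_const_mul 2 mG,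
            lintegral_const_mul 2 mH]
      _ ≤ _ := by
          gcongr
          · exact le_iSup₂ (f := fun (y : ℝ) (_ : 0 < y) => ∫⁻ x : ℝ, ‖G (x + y * I)‖ₑ ^ 2) y hy
          · exact le_iSup₂ (f := fun (y : ℝ) (_ : 0 < y) => ∫⁻ x : ℝ, ‖H (x + y * I)‖ₑ ^ 2) y hy
  · exact ENNReal.add_lt_top.2 ⟨ENNReal.mul_lt_top (by simp) hG.2,
      ENNReal.mul_lt_top (by simp) hH.2⟩

/-! ### Weak convergence in `L²` -/

/-- Almost everywhere convergence together with boundedness in `L²` gives convergence of the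
integrals against every function of `L²`. -/
theorem tendsto_integral_mul_of_ae_tendsto {ι : Type*} {l : Filter ι} [l.IsCountablyGenerated]
    {a : ι → ℝ → ℂ} {a₀ b : ℝ → ℂ} {M : ℝ≥0∞} (hM : M ≠ ∞)
    (ha : ∀ᶠ i in l, AEStronglyMeasurable (a i) volume ∧ ∫⁻ x, ‖a i x‖ₑ ^ 2 ≤ M)
    (hlim : ∀ᵐ x : ℝ, Tendsto (fun i => a i x) l (𝓝 (a₀ x)))
    (ha₀ : MemLp a₀ 2 volume) (hb : MemLp b 2 volume) :
    Tendsto (fun i => ∫ x, a i x * b x) l (𝓝 (∫ x, a₀ x * b x)) := by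
  have hint : ∀ {u : ℝ → ℂ}, MemLp u 2 volume → Integrable (fun x => u x * b x) :=
    fun hu => integrable_mul_of_memLp_two hu hb
  refine tendsto_integral_of_L1 _ (hint ha₀).1 ?_ ?_
  · filter_upwards [ha] with i hi
    exact hint (memLp_two_of_lintegral hi.1 (hi.2.trans_lt hM.lt_top))
  set K : ℝ≥0∞ := 2 * M + 2 * ∫⁻ x, ‖a₀ x‖ₑ ^ 2 with hK
  have hKt : K ≠ ∞ := by
    refine (ENNReal.add_lt_top.2 ⟨ENNReal.mul_lt_top (by simp) hM.lt_top,
      ENNReal.mul_lt_top (by simp) (lintegral_lt_top_of_memLp_two ha₀)⟩).ne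
  have hmd : ∀ᶠ i in l, AEMeasurable (fun x => ‖a i x - a₀ x‖ₑ) volume := by
    filter_upwards [ha] with i hi
    exact (hi.1.sub ha₀.1).enorm
  have hd : ∀ᶠ i in l, ∫⁻ x, ‖a i x - a₀ x‖ₑ ^ 2 ≤ K := by
    filter_upwards [ha] with i hi
    calc ∫⁻ x, ‖a i x - a₀ x‖ₑ ^ 2
        ≤ ∫⁻ x, (2 * ‖a i x‖ₑ ^ 2 + 2 * ‖a₀ x‖ₑ ^ 2) := by
          refine lintegral_mono fun x => ?_
          simpa [sub_eq_add_neg] using enorm_add_sq_le (a i x) (-a₀ x)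
      _ = 2 * (∫⁻ x, ‖a i x‖ₑ ^ 2) + 2 * ∫⁻ x, ‖a₀ x‖ₑ ^ 2 := by
          rw [lintegral_add_left' ((hi.1.enorm.pow_const 2).const_mul 2),
            lintegral_const_mul' _ _ (by simp), lintegral_const_mul' _ _ (by simp)]
      _ ≤ K := by
          rw [hK]
          gcongr
          exact hi.2
  rw [ENNReal.tendsto_nhds_zero]
  intro ε hε
  -- `δ` weighs the quadratic term of the pointwise bound `hpt`
  obtain ⟨δ, hδ0, hδ⟩ : ∃ δ : NNReal, 0 < δ ∧ (δ : ℝ≥0∞) * K ≤ ε / 2 := by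
    obtain ⟨δ, hδ0, hδ⟩ := ENNReal.exists_nnreal_pos_mul_lt hKt (ENNReal.half_pos hε.ne').ne'
    exact ⟨δ, hδ0, hδ.le⟩
  -- where `|d| > |b| / δ` the product `|d| |b|` is at most `δ |d|²`, elsewhere it is dominated
  have hpt : ∀ d c : ℂ, ‖d * c‖ₑ ≤
      δ * ‖d‖ₑ ^ 2 + min (‖d‖ₑ * ‖c‖ₑ) ((δ : ℝ≥0∞)⁻¹ * ‖c‖ₑ ^ 2) := by
    intro d c
    rw [enorm_mul]
    rcases le_total (‖c‖ₑ) (δ * ‖d‖ₑ) with h | h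
    · calc ‖d‖ₑ * ‖c‖ₑ ≤ ‖d‖ₑ * (δ * ‖d‖ₑ) := by gcongr
        _ = δ * ‖d‖ₑ ^ 2 := by ring
        _ ≤ _ := le_self_add
    · have h' : ‖d‖ₑ ≤ (δ : ℝ≥0∞)⁻¹ * ‖c‖ₑ := by
        rw [mul_comm, ← div_eq_mul_inv, ENNReal.le_div_iff_mul_le (by simp [hδ0.ne']) (by simp)]
        rwa [mul_comm]
      rw [min_eq_left]
      · exact le_add_self
      · calc ‖d‖ₑ * ‖c‖ₑ ≤ ((δ : ℝ≥0∞)⁻¹ * ‖c‖ₑ) * ‖c‖ₑ := by gcongr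
          _ = _ := by ring
  have hmin : Tendsto (fun i => ∫⁻ x, min (‖a i x - a₀ x‖ₑ * ‖b x‖ₑ) ((δ : ℝ≥0∞)⁻¹ * ‖b x‖ₑ ^ 2))
      l (𝓝 (∫⁻ _ : ℝ, 0)) := by
    refine tendsto_lintegral_filter_of_dominated_convergence'
      (fun x => (δ : ℝ≥0∞)⁻¹ * ‖b x‖ₑ ^ 2) ?_ ?_ ?_ ?_
    · filter_upwards [hmd] with i hi
      exact (hi.mul hb.1.enorm).min ((hb.1.enorm.pow_const 2).const_mul _)
    · exact Eventually.of_forall fun i => Eventually.of_forall fun x => min_le_right _ _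
    · rw [lintegral_const_mul' _ _ (by simp [hδ0.ne'])]
      exact ENNReal.mul_ne_top (by simp [hδ0.ne']) (lintegral_lt_top_of_memLp_two hb).ne
    · filter_upwards [hlim] with x hx
      have h1 : Tendsto (fun i => ‖a i x - a₀ x‖ₑ * ‖b x‖ₑ) l (𝓝 0) := by
        have h2 : Tendsto (fun i => ‖a i x - a₀ x‖ₑ) l (𝓝 0) := by
          simpa using (hx.sub_const (a₀ x)).enorm
        simpa using ENNReal.Tendsto.mul_const h2 (Or.inr (by simp : ‖b x‖ₑ ≠ ∞))
      refine tendsto_of_tendsto_of_tendsto_of_le_of_le tendsto_const_nhds h1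
        (fun _ => zero_le) (fun _ => min_le_left _ _)
  rw [lintegral_zero, ENNReal.tendsto_nhds_zero] at hmin
  filter_upwards [hmd, hd, hmin (ε / 2) (ENNReal.half_pos hε.ne')] with i h1 h2 h3
  calc ∫⁻ x, ‖a i x * b x - a₀ x * b x‖ₑ
      ≤ ∫⁻ x, (δ * ‖a i x - a₀ x‖ₑ ^ 2 +
          min (‖a i x - a₀ x‖ₑ * ‖b x‖ₑ) ((δ : ℝ≥0∞)⁻¹ * ‖b x‖ₑ ^ 2)) := by
        refine lintegral_mono fun x => ?_
        rw [← sub_mul]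
        exact hpt _ _
    _ = δ * (∫⁻ x, ‖a i x - a₀ x‖ₑ ^ 2) +
          ∫⁻ x, min (‖a i x - a₀ x‖ₑ * ‖b x‖ₑ) ((δ : ℝ≥0∞)⁻¹ * ‖b x‖ₑ ^ 2) := by
        rw [lintegral_add_left' ((h1.pow_const 2).const_mul _),
          lintegral_const_mul' _ _ (by simp)]
    _ ≤ ε / 2 + ε / 2 := by
        gcongr
        exact le_trans (by gcongr) hδ
    _ = ε := ENNReal.add_halves ε

/-! ### Cauchy's theorem and Cauchy's formula -/

/-- A function with finite integral over `ℝ` is frequently small along any filter all of whose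
sets have infinite measure. -/
theorem frequently_lt_of_lintegral_lt_top {v : ℝ → ℝ≥0∞} (hm : AEMeasurable v volume)
    (hv : ∫⁻ x, v x < ∞) {l : Filter ℝ} (hl : ∀ s ∈ l, (volume : Measure ℝ) s = ∞) {ε : ℝ≥0∞}
    (hε : ε ≠ 0) : ∃ᶠ x in l, v x < ε := by
  intro h
  have hs : volume {x | ε ≤ v x} = ∞ := by
    refine hl _ ?_
    filter_upwards [h] with x hx using not_lt.1 hx
  have h1 := mul_meas_ge_le_lintegral₀ hm ε
  rw [hs, ENNReal.mul_top hε] at h1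
  exact absurd hv (not_lt.2 h1)

/-- The integrals of an analytic function over horizontal lines do not depend on the line, if they
are absolutely convergent with a uniform bound: in Cauchy's theorem for rectangles, the integrals
over the vertical sides are small for suitable abscissae. -/
theorem integral_horizontal_eq {h : ℂ → ℂ} (hd : DifferentiableOn ℂ h {z : ℂ | 0 < z.im})
    {C : ℝ≥0∞} (hC : C ≠ ∞) (hb : ∀ y : ℝ, 0 < y → ∫⁻ x : ℝ, ‖h (x + y * I)‖ₑ ≤ C)
    {y Y : ℝ} (hy : 0 < y) (hyY : y ≤ Y) :
    ∫ x : ℝ, h (x + y * I) = ∫ x : ℝ, h (x + Y * I) := by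
  have hcont : ∀ t : ℝ, 0 < t → Continuous (fun x : ℝ => h (x + t * I)) := by
    intro t ht
    refine hd.continuousOn.comp_continuous (by fun_prop) fun x => ?_
    simpa using ht
  have hint : ∀ t : ℝ, 0 < t → Integrable (fun x : ℝ => h (x + t * I)) := fun t ht =>
    ⟨(hcont t ht).aestronglyMeasurable, (hb t ht).trans_lt hC.lt_top⟩
  set v : ℝ → ℝ≥0∞ := fun x => ∫⁻ t in Ioc y Y, ‖h (x + t * I)‖ₑ with hv
  have hm : AEMeasurable (Function.uncurry fun x t : ℝ => ‖h (x + t * I)‖ₑ)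
      ((volume : Measure ℝ).prod ((volume : Measure ℝ).restrict (Ioc y Y))) := by
    have hco : ContinuousOn (Function.uncurry fun x t : ℝ => h (x + t * I))
        (univ ×ˢ Ioc y Y) := by
      refine hd.continuousOn.comp (Continuous.continuousOn
        (f := fun p : ℝ × ℝ => (p.1 : ℂ) + p.2 * I) (by fun_prop)) ?_
      rintro ⟨x, t⟩ ⟨-, ht⟩
      simpa using hy.trans ht.1
    have := (hco.aestronglyMeasurable (μ := (volume : Measure ℝ).prod volume)
      (MeasurableSet.univ.prod measurableSet_Ioc)).enorm
    rw [← Measure.prod_restrict, Measure.restrict_univ] at this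
    exact this
  have hvfin : ∫⁻ x, v x < ∞ := by
    rw [hv, lintegral_lintegral_swap hm]
    calc ∫⁻ t in Ioc y Y, ∫⁻ x : ℝ, ‖h (x + t * I)‖ₑ ≤ ∫⁻ _ in Ioc y Y, C :=
          setLIntegral_mono measurable_const fun t ht => hb t (hy.trans ht.1)
      _ < ∞ := by
          rw [setLIntegral_const]
          exact ENNReal.mul_lt_top hC.lt_top (by simp)
  have hvert : ∀ x : ℝ, ‖∫ t in y..Y, h (x + t * I)‖ₑ ≤ v x := fun x => by
    rw [intervalIntegral.integral_of_le hyY]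
    exact enorm_integral_le_lintegral_enorm _
  have hrect : ∀ a b : ℝ, ‖(∫ x in a..b, h (x + y * I)) - ∫ x in a..b, h (x + Y * I)‖ₑ ≤
      v a + v b := by
    intro a b
    have h1 := integral_boundary_rect_eq_zero_of_differentiableOn h (a + y * I) (b + Y * I) (by
      refine hd.mono ?_
      rintro z ⟨-, hz⟩
      have : z.im ∈ uIcc y Y := by simpa using hz
      rw [uIcc_of_le hyY] at this
      exact hy.trans_le this.1)
    simp only [add_re, ofReal_re, mul_re, I_re, mul_zero, ofReal_im, I_im, mul_one, sub_self,
      add_zero, add_im, mul_im, zero_add, smul_eq_mul] at h1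
    have h2 : (∫ x in a..b, h (x + y * I)) - ∫ x in a..b, h (x + Y * I) =
        I * (∫ t in y..Y, h (a + t * I)) - I * ∫ t in y..Y, h (b + t * I) := by
      linear_combination h1
    rw [h2]
    refine (enorm_sub_le).trans ?_
    rw [enorm_mul, enorm_mul]
    have hI : ‖I‖ₑ = 1 := by rw [← ofReal_norm]; simp
    rw [hI, one_mul, one_mul]
    exact add_le_add (hvert a) (hvert b)
  by_contra hne
  set d := (∫ x : ℝ, h (x + y * I)) - ∫ x : ℝ, h (x + Y * I) with hdd
  have hd0 : 0 < ‖d‖ₑ := by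
    rw [enorm_pos]
    exact sub_ne_zero.2 hne
  have hlim : Tendsto (fun p : ℝ × ℝ =>
      ‖(∫ x in p.1..p.2, h (x + y * I)) - ∫ x in p.1..p.2, h (x + Y * I)‖ₑ)
      (atBot ×ˢ atTop) (𝓝 ‖d‖ₑ) :=
    ((intervalIntegral_tendsto_integral (hint y hy) tendsto_fst tendsto_snd).sub
      (intervalIntegral_tendsto_integral (hint Y (hy.trans_le hyY)) tendsto_fst tendsto_snd)).enorm
  have hev := (hlim.eventually_const_lt (ENNReal.half_lt_self hd0.ne' enorm_ne_top)).curry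
  have hq : ‖d‖ₑ / 2 / 2 ≠ 0 := by simp [hd0.ne']
  have hbot : ∃ᶠ x in atBot, v x < ‖d‖ₑ / 2 / 2 := by
    refine frequently_lt_of_lintegral_lt_top hm.lintegral_prod_right' hvfin (fun s hs => ?_) hq
    obtain ⟨N, hN⟩ := mem_atBot_sets.1 hs
    exact top_unique (Real.volume_Iic.symm.le.trans (measure_mono hN))
  have htop : ∃ᶠ x in atTop, v x < ‖d‖ₑ / 2 / 2 := by
    refine frequently_lt_of_lintegral_lt_top hm.lintegral_prod_right' hvfin (fun s hs => ?_) hq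
    obtain ⟨N, hN⟩ := mem_atTop_sets.1 hs
    exact top_unique (Real.volume_Ici.symm.le.trans (measure_mono hN))
  obtain ⟨a, ha, ha'⟩ := (hbot.and_eventually hev).exists
  obtain ⟨b, hb, hb'⟩ := (htop.and_eventually ha').exists
  have h3 := (hrect a b).trans (add_le_add ha.le hb.le)
  rw [ENNReal.add_halves] at h3
  exact absurd hb' (not_lt.2 h3)

theorem lintegral_enorm_mul_le {a b : ℝ → ℂ} (ha : AEStronglyMeasurable a volume)
    (hb : AEStronglyMeasurable b volume) :
    ∫⁻ x, ‖a x * b x‖ₑ ≤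
      (∫⁻ x, ‖a x‖ₑ ^ 2) ^ (1 / 2 : ℝ) * (∫⁻ x, ‖b x‖ₑ ^ 2) ^ (1 / 2 : ℝ) := by
  have h := ENNReal.lintegral_mul_le_Lp_mul_Lq volume Real.HolderConjugate.two_two
    ha.enorm hb.enorm
  simpa [enorm_mul] using h

/-- A function of `H_2` whose values on the real line are its boundary values, almost everywhere,
and form a function of `L²(ℝ)`. -/
structure HardyBoundary (F : ℂ → ℂ) : Prop where
  memHardyTwo : MemHardyTwo F
  memLp : MemLp (fun x : ℝ => F x) 2 volume
  tendsto : ∀ᵐ x : ℝ, Tendsto (fun y : ℝ => F (x + y * I)) (𝓝[>] 0) (𝓝 (F x))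

theorem MemHardyTwo.exists_lintegral_le {F : ℂ → ℂ} (hF : MemHardyTwo F) :
    ∃ M : ℝ≥0∞, M ≠ ∞ ∧ ∀ y : ℝ, 0 < y → ∫⁻ x : ℝ, ‖F (x + y * I)‖ₑ ^ 2 ≤ M :=
  ⟨_, hF.2.ne, fun y hy =>
    le_iSup₂ (f := fun (y : ℝ) (_ : 0 < y) => ∫⁻ x : ℝ, ‖F (x + y * I)‖ₑ ^ 2) y hy⟩

/-- Cauchy's theorem in `H_2`, with the kernel of a pole in the lower half-plane. -/
theorem HardyBoundary.integral_mul_inv_add {F : ℂ → ℂ} (hF : HardyBoundary F) {R : ℝ}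
    (hR : 0 < R) : ∫ x : ℝ, F x * ((x : ℂ) + R * I)⁻¹ = 0 := by
  obtain ⟨M, hM, hMb⟩ := hF.memHardyTwo.exists_lintegral_le
  set k : ℂ → ℂ := fun z => (z + R * I)⁻¹ with hk
  have hkH : MemHardyTwo k := memHardyTwo_inv_add_mul_I hR
  have hkb : ∀ y : ℝ, 0 < y →
      ∫⁻ x : ℝ, ‖k (x + y * I)‖ₑ ^ 2 = ENNReal.ofReal (Real.pi / (y + R)) := by
    intro y hy
    rw [← lintegral_enorm_inv_add_mul_I (by linarith)]
    congr 1
    funext x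
    rw [hk]
    congr 4
    push_cast
    ring
  have hholder : ∀ y : ℝ, 0 < y → ∫⁻ x : ℝ, ‖F (x + y * I) * k (x + y * I)‖ₑ ≤
      M ^ (1 / 2 : ℝ) * ENNReal.ofReal (Real.pi / (y + R)) ^ (1 / 2 : ℝ) := by
    intro y hy
    refine (lintegral_enorm_mul_le (hF.memHardyTwo.measurable_line hy).aestronglyMeasurable
      (hkH.measurable_line hy).aestronglyMeasurable).trans ?_
    rw [hkb y hy]
    gcongr
    exact hMb y hy
  have hM2 : M ^ (1 / 2 : ℝ) ≠ ∞ := ENNReal.rpow_ne_top_of_nonneg (by norm_num) hM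
  have hconst : ∀ y Y : ℝ, 0 < y → y ≤ Y → ∫ x : ℝ, F (x + y * I) * k (x + y * I) =
      ∫ x : ℝ, F (x + Y * I) * k (x + Y * I) := by
    intro y Y hy hyY
    refine integral_horizontal_eq (h := fun z => F z * k z)
      (C := M ^ (1 / 2 : ℝ) * ENNReal.ofReal (Real.pi / R) ^ (1 / 2 : ℝ))
      (hF.memHardyTwo.1.mul hkH.1) ?_ (fun t ht => (hholder t ht).trans ?_) hy hyY
    · exact ENNReal.mul_ne_top hM2
        (ENNReal.rpow_ne_top_of_nonneg (by norm_num) ENNReal.ofReal_ne_top)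
    · gcongr
      linarith
  -- the integrals over the lines do not depend on the height and tend to `0` as it increases
  have hzero : ∀ y : ℝ, 0 < y → ∫ x : ℝ, F (x + y * I) * k (x + y * I) = 0 := by
    intro y hy
    have hlim : Tendsto (fun Y : ℝ => M ^ (1 / 2 : ℝ) *
        ENNReal.ofReal (Real.pi / (Y + R)) ^ (1 / 2 : ℝ)) atTop (𝓝 0) := by
      have h1 : Tendsto (fun Y : ℝ => Real.pi / (Y + R)) atTop (𝓝 0) :=
        tendsto_const_nhds.div_atTop (tendsto_atTop_add_const_right _ _ tendsto_id)
      have h2 := ENNReal.Tendsto.const_mul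
        ((ENNReal.tendsto_ofReal h1).ennrpow_const (1 / 2)) (Or.inr hM2)
      simpa using h2
    have hle : ‖∫ x : ℝ, F (x + y * I) * k (x + y * I)‖ₑ ≤ 0 := by
      refine ge_of_tendsto hlim ?_
      filter_upwards [eventually_ge_atTop y] with Y hY
      rw [hconst y Y hy hY]
      exact (enorm_integral_le_lintegral_enorm _).trans (hholder Y (hy.trans_le hY))
    simpa using hle
  have hne : ∀ (x : ℝ) {y : ℝ}, 0 ≤ y → (x : ℂ) + y * I + R * I ≠ 0 := by
    intro x y hy
    have := ofReal_add_mul_I_ne_zero x (R := y + R) (by linarith)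
    rwa [ofReal_add, add_mul, ← add_assoc] at this
  have hlim := tendsto_integral_mul_of_ae_tendsto (l := 𝓝[>] (0 : ℝ))
    (a := fun y x => F (x + y * I) * (((x : ℂ) + R * I) / (x + y * I + R * I)))
    (a₀ := fun x : ℝ => F x) (b := fun x : ℝ => ((x : ℂ) + R * I)⁻¹) hM ?_ ?_ hF.memLp
    (memLp_inv_add_mul_I hR.ne')
  · refine tendsto_nhds_unique hlim (tendsto_const_nhds.congr' ?_)
    filter_upwards [self_mem_nhdsWithin] with y hy
    rw [← hzero y hy]
    congr 1
    funext x
    have h1 := ofReal_add_mul_I_ne_zero x hR.ne'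
    rw [mul_assoc, div_mul_eq_mul_div, mul_inv_cancel₀ h1, one_div]
  · filter_upwards [self_mem_nhdsWithin] with y hy
    have hy' : 0 < y := hy
    refine ⟨?_, le_trans (lintegral_mono fun x => ?_) (hMb y hy)⟩
    · refine (hF.memHardyTwo.measurable_line hy).aestronglyMeasurable.mul ?_
      exact (Continuous.div (by fun_prop) (by fun_prop)
        fun x => hne x hy'.le).aestronglyMeasurable
    · gcongr ?_ ^ 2
      rw [enorm_mul]
      refine mul_le_of_le_one_right' ?_
      have : ‖((x : ℂ) + R * I) / (x + y * I + R * I)‖ ≤ 1 := by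
        rw [norm_div]
        refine div_le_one_of_le₀ ?_ (norm_nonneg _)
        have e1 : (x : ℂ) + y * I + R * I = x + ((y + R : ℝ) : ℂ) * I := by push_cast; ring
        rw [e1]
        refine le_of_sq_le_sq ?_ (norm_nonneg _)
        rw [norm_ofReal_add_mul_I_sq, norm_ofReal_add_mul_I_sq]
        nlinarith
      rw [← ofReal_norm]
      exact ENNReal.ofReal_le_one.2 this
  · filter_upwards [hF.tendsto] with x hx
    have h0 : Tendsto (fun y : ℝ => ((x : ℂ) + R * I) / (x + y * I + R * I)) (𝓝[>] 0) (𝓝 1) := by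
      have hc : ContinuousAt (fun y : ℝ => ((x : ℂ) + R * I) / (x + y * I + R * I)) 0 :=
        ContinuousAt.div (by fun_prop) (by fun_prop) (hne x le_rfl)
      have := hc.tendsto.mono_left (nhdsWithin_le_nhds (s := Ioi 0))
      simpa [div_self (ofReal_add_mul_I_ne_zero x hR.ne')] using this
    simpa using hx.mul h0

/-- Moving a pole of the kernel across the line: if `F` is in `H_2`, so is the difference quotient
at `R i` of `(z + R i) F(z)`. -/
theorem HardyBoundary.dslope {F : ℂ → ℂ} (hF : HardyBoundary F) {R : ℝ} (hR : 0 < R) :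
    HardyBoundary (dslope (fun z => F z * (z + R * I)) (R * I)) := by
  set N : ℂ → ℂ := fun z => F z * (z + R * I) with hN
  set P : ℂ → ℂ := _root_.dslope N (R * I) with hP
  have hopen : IsOpen {z : ℂ | 0 < z.im} := isOpen_lt continuous_const continuous_im
  have hmem : (R : ℂ) * I ∈ {z : ℂ | 0 < z.im} := by simpa using hR
  have hNd : DifferentiableOn ℂ N {z : ℂ | 0 < z.im} :=
    hF.memHardyTwo.1.mul (by fun_prop)
  have hPd : DifferentiableOn ℂ P {z : ℂ | 0 < z.im} :=
    (Complex.differentiableOn_dslope (hopen.mem_nhds hmem)).2 hNd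
  have hPe : ∀ z : ℂ, z ≠ R * I → P z = (N z - N (R * I)) / (z - R * I) := by
    intro z hz
    rw [hP, dslope_of_ne _ hz, slope_def_field]
  have hball : Metric.closedBall ((R : ℂ) * I) (R / 2) ⊆ {z : ℂ | 0 < z.im} := by
    intro z hz
    rw [Metric.mem_closedBall, dist_eq_norm] at hz
    have h1 := (abs_im_le_norm (z - R * I)).trans hz
    simp only [sub_im, mul_im, ofReal_re, I_im, mul_one, ofReal_im, I_re, mul_zero, add_zero] at h1
    have := (abs_le.1 h1).1
    change 0 < z.im
    linarith
  obtain ⟨C, hC⟩ := (isCompact_closedBall ((R : ℂ) * I) (R / 2)).exists_bound_of_continuousOn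
    (hPd.continuousOn.mono hball)
  have hC0 : 0 ≤ C := (norm_nonneg _).trans
    (hC (R * I) (Metric.mem_closedBall_self (by positivity)))
  have hRI : ‖(R : ℂ) * I‖ = R := by simp [abs_of_pos hR]
  have htri : ∀ z : ℂ, ‖z + R * I‖ ≤ ‖z - R * I‖ + 2 * R := by
    intro z
    have : z + R * I = (z - R * I) + 2 * (R * I) := by ring
    rw [this]
    refine (norm_add_le _ _).trans ?_
    rw [norm_mul, hRI]
    simp
  have hbound : ∀ z : ℂ, 0 ≤ z.im → ‖P z‖ ≤
      ‖(5 : ℂ) * F z‖ + ‖((C * (5 * R) + ‖N (R * I)‖ * 5 : ℝ) : ℂ) * (z + R * I)⁻¹‖ := by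
    intro z hz
    have hpos : 0 < ‖z + R * I‖ := by
      rw [norm_pos_iff]
      intro h
      have := congrArg im h
      simp at this
      linarith
    have hK : ‖((C * (5 * R) + ‖N (R * I)‖ * 5 : ℝ) : ℂ) * (z + R * I)⁻¹‖ =
        (C * (5 * R) + ‖N (R * I)‖ * 5) / ‖z + R * I‖ := by
      rw [norm_mul, norm_real, Real.norm_of_nonneg (by positivity), norm_inv, div_eq_mul_inv]
    rw [hK, norm_mul]
    have h5 : ‖(5 : ℂ)‖ = 5 := by simp
    rw [h5]
    rcases le_total ‖z - R * I‖ (R / 2) with hle | hle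
    · have h1 := hC z (by rwa [Metric.mem_closedBall, dist_eq_norm])
      have h2 := htri z
      have h3 : C ≤ (C * (5 * R) + ‖N (R * I)‖ * 5) / ‖z + R * I‖ := by
        rw [le_div_iff₀ hpos]
        have : C * ‖z + R * I‖ ≤ C * (5 * R) := by
          gcongr
          linarith
        nlinarith [norm_nonneg (N (R * I))]
      nlinarith [norm_nonneg (F z)]
    · -- here `|z + R i| ≤ |z - R i| + 2 R ≤ 5 |z - R i|`
      have hlt : 0 < ‖z - R * I‖ := by linarith
      have hz' : z ≠ R * I := fun h => by rw [h] at hlt; simp at hlt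
      have h5' : ‖z + R * I‖ ≤ 5 * ‖z - R * I‖ := by linarith [htri z]
      rw [hPe z hz', norm_div]
      calc ‖N z - N (R * I)‖ / ‖z - R * I‖
          ≤ (‖N z‖ + ‖N (R * I)‖) / ‖z - R * I‖ := by gcongr; exact norm_sub_le _ _
        _ = ‖F z‖ * (‖z + R * I‖ / ‖z - R * I‖) + ‖N (R * I)‖ / ‖z - R * I‖ := by
            rw [hN]
            simp only [norm_mul]
            ring
        _ ≤ ‖F z‖ * 5 + (C * (5 * R) + ‖N (R * I)‖ * 5) / ‖z + R * I‖ := by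
            refine add_le_add (mul_le_mul_of_nonneg_left ?_ (norm_nonneg _)) ?_
            · rwa [div_le_iff₀ hlt]
            · rw [div_le_div_iff₀ hlt hpos]
              have : 0 ≤ C * (5 * R) * ‖z - R * I‖ := by positivity
              nlinarith [mul_le_mul_of_nonneg_left h5' (norm_nonneg (N (R * I)))]
        _ = _ := by ring
  have hne : ∀ x : ℝ, (x : ℂ) ≠ R * I := fun x h =>
    ofReal_sub_mul_I_ne_zero x hR.ne' (sub_eq_zero.2 h)
  refine ⟨?_, ?_, ?_⟩
  · exact MemHardyTwo.of_norm_le (hF.memHardyTwo.const_mul 5)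
      ((memHardyTwo_inv_add_mul_I hR).const_mul _) hPd fun z hz => hbound z hz.le
  · have hm : AEStronglyMeasurable (fun x : ℝ => P x) volume := by
      have : (fun x : ℝ => P x) = fun x : ℝ => (F x * (x + R * I) - N (R * I)) *
          ((x : ℂ) - R * I)⁻¹ := by
        funext x
        rw [hPe x (hne x), div_eq_mul_inv]
      rw [this]
      refine ((hF.memLp.1.mul (Continuous.aestronglyMeasurable (by fun_prop))).sub
        aestronglyMeasurable_const).mul (memLp_inv_sub_mul_I hR.ne').1
    refine MemLp.mono (((hF.memLp.const_mul 5).norm).add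
      (((memLp_inv_add_mul_I hR.ne').const_mul
        ((C * (5 * R) + ‖N (R * I)‖ * 5 : ℝ) : ℂ)).norm)) hm (Eventually.of_forall fun x => ?_)
    exact (hbound x (by simp)).trans (le_abs_self _)
  · filter_upwards [hF.tendsto] with x hx
    have hz : Tendsto (fun y : ℝ => (x : ℂ) + y * I) (𝓝[>] 0) (𝓝 x) := by
      have hc : ContinuousAt (fun y : ℝ => (x : ℂ) + y * I) 0 := by fun_prop
      simpa using hc.tendsto.mono_left (nhdsWithin_le_nhds (s := Ioi 0))
    have h1 : Tendsto (fun y : ℝ => (N (x + y * I) - N (R * I)) / ((x : ℂ) + y * I - R * I))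
        (𝓝[>] 0) (𝓝 (P x)) := by
      rw [hPe x (hne x)]
      exact ((hx.mul (hz.add_const _)).sub_const _).div (hz.sub_const _)
        (sub_ne_zero.2 (hne x))
    refine h1.congr' ?_
    filter_upwards [hz.eventually_ne (hne x)] with y hy
    rw [hPe _ hy]

/-- Cauchy's formula in `H_2`. -/
theorem HardyBoundary.integral_mul_inv_sub {F : ℂ → ℂ} (hF : HardyBoundary F) {R : ℝ}
    (hR : 0 < R) :
    ∫ x : ℝ, F x * ((x : ℂ) - R * I)⁻¹ = 2 * Real.pi * I * F (R * I) := by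
  have h := (hF.dslope hR).integral_mul_inv_add hR
  have hpt : ∀ x : ℝ, _root_.dslope (fun z => F z * (z + R * I)) (R * I) x *
      ((x : ℂ) + R * I)⁻¹ = F x * ((x : ℂ) - R * I)⁻¹ -
        F (R * I) * (2 * R * I) * (((x ^ 2 + R ^ 2)⁻¹ : ℝ) : ℂ) := by
    intro x
    have h1 := ofReal_add_mul_I_ne_zero x hR.ne'
    have h2 := ofReal_sub_mul_I_ne_zero x hR.ne'
    have h3 : (x : ℂ) ^ 2 + (R : ℂ) ^ 2 = (x + R * I) * (x - R * I) := by
      linear_combination (R : ℂ) ^ 2 * I_sq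
    rw [dslope_of_ne _ (sub_ne_zero.1 h2), slope_def_field]
    push_cast
    rw [h3]
    generalize F (R * I) = c
    generalize F x = d
    field_simp
    ring
  simp only [hpt] at h
  have hint : Integrable fun x : ℝ =>
      F (R * I) * (2 * R * I) * (((x ^ 2 + R ^ 2)⁻¹ : ℝ) : ℂ) :=
    (integrable_inv_sq_add_sq hR).ofReal.const_mul _
  rw [integral_sub (integrable_mul_of_memLp_two hF.memLp (memLp_inv_sub_mul_I hR.ne'))
    hint, integral_const_mul,
    integral_complex_ofReal, integral_univ_inv_sq_add_sq hR, sub_eq_zero] at h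
  rw [h]
  have : (R : ℂ) ≠ 0 := ofReal_ne_zero.2 hR.ne'
  push_cast
  field_simp

theorem lintegral_enorm_sqrt_mul_inv_sub {R : ℝ} (hR : 0 < R) :
    ∫⁻ x : ℝ, ‖(√R : ℂ) * ((x : ℂ) - R * I)⁻¹‖ₑ ^ 2 = ENNReal.ofReal Real.pi := by
  have h := lintegral_enorm_inv_add_mul_I hR
  have h2 : ∀ x : ℝ, ‖(√R : ℂ) * ((x : ℂ) - R * I)⁻¹‖ₑ ^ 2 =
      ENNReal.ofReal R * ‖((x : ℂ) + R * I)⁻¹‖ₑ ^ 2 := by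
    intro x
    rw [← ofReal_norm, ← ofReal_norm, ← ENNReal.ofReal_pow (norm_nonneg _),
      ← ENNReal.ofReal_pow (norm_nonneg _), ← ENNReal.ofReal_mul hR.le, norm_mul, mul_pow,
      norm_inv, norm_inv, inv_pow, inv_pow, norm_ofReal_sub_mul_I_sq, norm_ofReal_add_mul_I_sq,
      norm_real, Real.norm_of_nonneg (Real.sqrt_nonneg _), Real.sq_sqrt hR.le]
  simp only [h2]
  rw [lintegral_const_mul' _ _ ENNReal.ofReal_ne_top, h, ← ENNReal.ofReal_mul hR.le]
  congr 1
  field_simp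

/-- Functions of `H_2` are `o(R ^ (-1/2))` at `R i`. -/
theorem HardyBoundary.tendsto_sqrt_mul {F : ℂ → ℂ} (hF : HardyBoundary F) :
    Tendsto (fun R : ℝ => (√R : ℂ) * F (R * I)) atTop (𝓝 0) := by
  have h := tendsto_integral_mul_of_ae_tendsto (l := (atTop : Filter ℝ))
    (a := fun R x => (√R : ℂ) * ((x : ℂ) - R * I)⁻¹) (a₀ := fun _ => 0) (b := fun x : ℝ => F x)
    (M := ENNReal.ofReal Real.pi) ENNReal.ofReal_ne_top ?_ ?_ (by simp) hF.memLp
  · simp only [zero_mul, integral_zero] at h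
    have h2 := h.const_mul (2 * Real.pi * I)⁻¹
    rw [mul_zero] at h2
    refine h2.congr' ?_
    filter_upwards [eventually_gt_atTop 0] with R hR
    have : ∀ x : ℝ, (√R : ℂ) * ((x : ℂ) - R * I)⁻¹ * F x =
        (√R : ℂ) * (F x * ((x : ℂ) - R * I)⁻¹) := fun x => by ring
    simp only [this]
    rw [integral_const_mul, hF.integral_mul_inv_sub hR]
    have h3 : (2 * Real.pi * I : ℂ) ≠ 0 := by simp [Real.pi_ne_zero]
    rw [mul_left_comm (√R : ℂ), inv_mul_cancel_left₀ h3]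
  · filter_upwards [eventually_gt_atTop 0] with R hR
    exact ⟨((memLp_inv_sub_mul_I hR.ne').const_mul _).1, (lintegral_enorm_sqrt_mul_inv_sub hR).le⟩
  · refine Eventually.of_forall fun x => ?_
    rw [tendsto_zero_iff_norm_tendsto_zero]
    have h1 : Tendsto (fun R : ℝ => (√R)⁻¹) atTop (𝓝 0) :=
      tendsto_inv_atTop_zero.comp Real.tendsto_sqrt_atTop
    refine squeeze_zero' (Eventually.of_forall fun R => norm_nonneg _) ?_ h1
    filter_upwards [eventually_gt_atTop 0] with R hR
    have h2 : R ≤ ‖(x : ℂ) - R * I‖ := by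
      have := abs_im_le_norm ((x : ℂ) - R * I)
      simp only [sub_im, ofReal_im, mul_im, ofReal_re, I_im, mul_one, I_re, mul_zero, add_zero,
        zero_sub, abs_neg, abs_of_pos hR] at this
      exact this
    rw [norm_mul, norm_inv, norm_real, Real.norm_of_nonneg (Real.sqrt_nonneg _)]
    calc √R * ‖(x : ℂ) - R * I‖⁻¹ ≤ √R * R⁻¹ := by gcongr
      _ = (√R)⁻¹ := by
        have : 0 < √R := Real.sqrt_pos.2 hR
        nth_rw 2 [← Real.mul_self_sqrt hR.le]
        field_simp

/-! ### Elementary properties of Hermite-Biehler functions -/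

@[simp] theorem sharp_sharp (f : ℂ → ℂ) : sharp (sharp f) = f := by
  funext z
  simp [sharp]

theorem sharp_ofReal (f : ℂ → ℂ) (x : ℝ) : sharp f x = conj (f x) := by
  simp [sharp]

theorem Differentiable.sharp {f : ℂ → ℂ} (hf : Differentiable ℂ f) :
    Differentiable ℂ (sharp f) := by
  intro z
  have h := (hf (conj z)).conj_conj
  rw [Complex.conj_conj] at h
  exact h

namespace HermiteBiehler

variable (e : HermiteBiehler)

theorem ne_zero_of_im_pos {z : ℂ} (hz : 0 < z.im) : e z ≠ 0 := fun h => by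
  have := e.norm_conj_lt' z hz
  rw [h, norm_zero] at this
  exact absurd this (not_lt.2 (norm_nonneg _))

theorem norm_sharp_le {z : ℂ} (hz : 0 ≤ z.im) : ‖sharp e z‖ ≤ ‖e z‖ := by
  rw [sharp, norm_conj]
  rcases hz.lt_or_eq with h | h
  · exact (e.norm_conj_lt' z h).le
  · rw [conj_eq_iff_im.2 h.symm]

theorem countable_zeros : {z : ℂ | e z = 0}.Countable := by
  have hea : AnalyticOnNhd ℂ e univ := e.differentiable'.differentiableOn.analyticOnNhd isOpen_univ
  have h := hea.preimage_zero_mem_codiscrete (e.ne_zero_of_im_pos (z := I) (by simp))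
  have h2 : DiscreteTopology ↑{z : ℂ | e z = 0} := by
    have : {z : ℂ | e z = 0} = (e ⁻¹' {0}ᶜ)ᶜ ∩ univ := by
      ext z
      simp
    rw [this]
    exact isDiscrete_iff_discreteTopology.mp
      (isDiscrete_of_codiscreteWithin ((compl_compl (e.toFun ⁻¹' {0}ᶜ)).symm ▸ h))
  exact TopologicalSpace.separableSpace_iff_countable.1 inferInstance

theorem ae_ne_zero : ∀ᵐ x : ℝ, e x ≠ 0 := by
  have : ((fun x : ℝ => (x : ℂ)) ⁻¹' {z : ℂ | e z = 0}).Countable :=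
    e.countable_zeros.preimage ofReal_injective
  exact this.ae_notMem volume

variable {e}

theorem sharp_mem {f : ℂ → ℂ} (hf : f ∈ e.carrier) : sharp f ∈ e.carrier :=
  ⟨hf.1.sharp, hf.2.2, by simpa using hf.2.1⟩

/-- The quotients `f / e` with `f ∈ B(e)` are functions of `H_2` with boundary values. -/
theorem hardyBoundary_div {f : ℂ → ℂ} (hf : f ∈ e.carrier) :
    HardyBoundary (fun z => f z / e z) := by
  refine ⟨hf.2.1, (Space.mk f hf).memLp, ?_⟩
  filter_upwards [e.ae_ne_zero] with x hx
  have hc : ContinuousAt (fun y : ℝ => (x : ℂ) + y * I) 0 := by fun_prop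
  have hz : Tendsto (fun y : ℝ => (x : ℂ) + y * I) (𝓝[>] 0) (𝓝 x) := by
    simpa using hc.tendsto.mono_left (nhdsWithin_le_nhds (s := Ioi 0))
  exact ((hf.1.continuous.tendsto _).comp hz).div ((e.differentiable'.continuous.tendsto _).comp hz)
    hx

variable (e)

theorem s_zero (z : ℂ) : e.s 0 z = I / 2 * (e z - sharp e z) := by
  simp [s]

/-- The normalized associated functions `s_{π/2} + t s_0`, which equal `s_β / sin β` for
`t = cot β`. -/
def assoc (t : ℝ) : ℂ → ℂ := fun z => -(e z + sharp e z) / 2 + t * e.s 0 z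

theorem s_eq_sin_mul_assoc {β : ℝ} (hβ : Real.sin β ≠ 0) (z : ℂ) :
    e.s β z = Real.sin β * e.assoc (Real.cot β) z := by
  have hβ' : (Real.sin β : ℂ) ≠ 0 := ofReal_ne_zero.2 hβ
  have h1 : exp (I * β) = Real.cos β + Real.sin β * I := by
    rw [mul_comm, exp_mul_I, ofReal_cos, ofReal_sin]
  have h2 : exp (-(I * β)) = Real.cos β - Real.sin β * I := by
    rw [mul_comm, ← neg_mul, exp_mul_I, cos_neg, sin_neg, ofReal_cos, ofReal_sin]
    ring
  rw [assoc, s_zero, s, h1, h2, Real.cot_eq_cos_div_sin, ofReal_div]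
  field_simp
  linear_combination (Real.sin β * (e z + sharp e z)) * I_sq

theorem assoc_eq_add (t : ℝ) (z : ℂ) : e.assoc t z = e.assoc 0 z + t * e.s 0 z := by
  simp [assoc]

theorem assoc_zero (z : ℂ) : e.assoc 0 z = -(e z + sharp e z) / 2 := by
  simp [assoc]

theorem differentiable_s (β : ℝ) : Differentiable ℂ (e.s β) :=
  ((e.differentiable'.const_mul _).sub (e.differentiable'.sharp.const_mul _)).const_mul _

theorem differentiable_assoc (t : ℝ) : Differentiable ℂ (e.assoc t) :=
  (((e.differentiable'.add e.differentiable'.sharp).neg).div_const 2).add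
    ((e.differentiable_s 0).const_mul _)

theorem sharp_s_zero : sharp (e.s 0) = e.s 0 := by
  funext z
  rw [sharp, s_zero, s_zero]
  simp only [sharp, map_mul, map_div₀, conj_I, map_sub, conj_conj, map_ofNat]
  ring

theorem sharp_assoc (t : ℝ) : sharp (e.assoc t) = e.assoc t := by
  funext z
  have h := congrFun e.sharp_s_zero z
  rw [sharp] at h
  simp only [sharp, assoc, map_add, map_div₀, map_neg, map_mul, conj_conj, map_ofNat, conj_ofReal]
  rw [h]
  ring

theorem assoc_conj (t : ℝ) (z : ℂ) : e.assoc t (conj z) = conj (e.assoc t z) := by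
  have := congrFun (e.sharp_assoc t) (conj z)
  rw [← this]
  simp [sharp]

theorem norm_assoc_le (t : ℝ) {z : ℂ} (hz : 0 ≤ z.im) : ‖e.assoc t z‖ ≤ (1 + |t|) * ‖e z‖ := by
  have h := e.norm_sharp_le hz
  have h1 : ‖-(e z + sharp e z) / 2‖ ≤ ‖e z‖ := by
    rw [norm_div, norm_neg]
    have := norm_add_le (e z) (sharp e z)
    norm_num
    linarith
  have h2 : ‖I / 2 * (e z - sharp e z)‖ ≤ ‖e z‖ := by
    rw [norm_mul, norm_div, norm_I]
    have := norm_sub_le (e z) (sharp e z)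
    norm_num
    linarith
  rw [assoc, s_zero]
  refine (norm_add_le _ _).trans ?_
  rw [norm_mul, norm_real, Real.norm_eq_abs]
  nlinarith [mul_le_mul_of_nonneg_left h2 (abs_nonneg t)]

/-- The associated functions have no zeros in the upper half-plane: at a zero,
`(-1 + t i) e = (1 + t i) e^#`, although `|e^#| < |e|`. -/
theorem assoc_ne_zero (t : ℝ) {z : ℂ} (hz : 0 < z.im) : e.assoc t z ≠ 0 := by
  intro h
  have hlt : ‖sharp e z‖ < ‖e z‖ := by
    rw [sharp, norm_conj]
    exact e.norm_conj_lt' z hz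
  have h1 : (-1 + t * I) * e z = (1 + t * I) * sharp e z := by
    rw [assoc, s_zero] at h
    linear_combination 2 * h
  have h2 := congrArg norm h1
  rw [norm_mul, norm_mul] at h2
  have h3 : ‖(-1 + t * I : ℂ)‖ = ‖(1 + t * I : ℂ)‖ := by
    rw [← sq_eq_sq₀ (norm_nonneg _) (norm_nonneg _)]
    have e1 := norm_ofReal_add_mul_I_sq (-1) t
    have e2 := norm_ofReal_add_mul_I_sq 1 t
    push_cast at e1 e2
    rw [e1, e2]
    ring
  have h4 : 0 < ‖(1 + t * I : ℂ)‖ := by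
    rw [norm_pos_iff]
    intro h
    simpa using congrArg re h
  rw [h3] at h2
  exact absurd (mul_left_cancel₀ h4.ne' h2) hlt.ne'

theorem assoc_ne_zero_of_im_neg (t : ℝ) {z : ℂ} (hz : z.im < 0) : e.assoc t z ≠ 0 := by
  intro h
  refine e.assoc_ne_zero t (z := conj z) (by simpa using hz) ?_
  rw [assoc_conj, h, map_zero]

theorem s_zero_ne_zero {z : ℂ} (hz : 0 < z.im) : e.s 0 z ≠ 0 := by
  intro h
  rw [s_zero, mul_eq_zero] at h
  rcases h with h | h
  · simp at h
  · have h1 := e.norm_conj_lt' z hz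
    rw [sub_eq_zero.1 h, sharp, norm_conj] at h1
    exact lt_irrefl _ h1

variable {e}

/-- Every function of `B(e)` vanishes at the real zeros of `e`, since `f / e` is square integrable
on the real line. -/
theorem apply_eq_zero_of_zero {f : ℂ → ℂ} (hf : f ∈ e.carrier) {u : ℝ} (hu : e u = 0) :
    f u = 0 := by
  by_contra hfu
  have hL : MemLp (fun x : ℝ => f x / e x) 2 volume := (Space.mk f hf).memLp
  have hint : IntervalIntegrable (fun x : ℝ => f x / e x) volume (u - 1) (u + 1) := by
    rw [intervalIntegrable_iff]
    have h2 : MemLp (fun x : ℝ => f x / e x) 2 (volume.restrict (uIoc (u - 1) (u + 1))) :=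
      hL.restrict _
    have : IsFiniteMeasure (volume.restrict (uIoc (u - 1) (u + 1))) :=
      ⟨by rw [Measure.restrict_apply_univ, uIoc_of_le (by linarith)]; simp⟩
    exact h2.integrable (by norm_num)
  refine not_intervalIntegrable_of_sub_inv_isBigO_punctured (c := u) ?_ (by linarith)
    (by rw [uIcc_of_le (by linarith)]; constructor <;> linarith) hint
  have hcoe : Tendsto (fun x : ℝ => (x : ℂ)) (𝓝[≠] u) (𝓝 (u : ℂ)) :=
    continuous_ofReal.continuousAt.tendsto.mono_left nhdsWithin_le_nhds
  have hcoe' : Tendsto (fun x : ℝ => (x : ℂ)) (𝓝[≠] u) (𝓝[≠] (u : ℂ)) := by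
    refine tendsto_nhdsWithin_iff.2 ⟨hcoe, ?_⟩
    filter_upwards [self_mem_nhdsWithin] with x hx
    simpa using hx
  have hne : ∀ᶠ x : ℝ in 𝓝[≠] u, e x ≠ 0 := by
    have hea : AnalyticOnNhd ℂ e univ :=
      e.differentiable'.differentiableOn.analyticOnNhd isOpen_univ
    rcases (hea u (mem_univ _)).eventually_eq_zero_or_eventually_ne_zero with h | h
    · exfalso
      have := hea.eq_of_eventuallyEq (g := fun _ => 0) analyticOnNhd_const h
      exact e.ne_zero_of_im_pos (z := I) (by simp) (congrFun this I)
    · exact hcoe'.eventually h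
  have heO : ∃ C : ℝ, 0 < C ∧ ∀ᶠ x : ℝ in 𝓝[≠] u, ‖e x‖ ≤ C * ‖(x : ℂ) - u‖ := by
    have h1 := (e.differentiable' u).isBigO_sub
    obtain ⟨C, hC0, hC⟩ := h1.exists_pos
    refine ⟨C, hC0, ?_⟩
    filter_upwards [hcoe.eventually hC.bound] with x hx
    simpa [hu] using hx
  obtain ⟨C, hC0, hC⟩ := heO
  have hfb : ∀ᶠ x : ℝ in 𝓝[≠] u, ‖f u‖ / 2 < ‖f x‖ :=
    ((hf.1.continuous.norm.tendsto u).comp hcoe).eventually_const_lt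
      (half_lt_self (norm_pos_iff.2 hfu))
  refine Asymptotics.IsBigO.of_bound (C / (‖f u‖ / 2)) ?_
  filter_upwards [hne, hC, hfb, self_mem_nhdsWithin] with x h1 h2 h3 h4
  have hx : 0 < ‖(x : ℂ) - u‖ := by
    rw [norm_pos_iff, sub_ne_zero]
    simpa using h4
  have hfu' : 0 < ‖f u‖ / 2 := half_pos (norm_pos_iff.2 hfu)
  have he : 0 < ‖e x‖ := norm_pos_iff.2 h1
  have e1 : ‖(x - u)⁻¹‖ = ‖(x : ℂ) - u‖⁻¹ := by
    rw [norm_inv, ← ofReal_sub, norm_real]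
  rw [e1, norm_div, inv_le_iff_one_le_mul₀ hx]
  rw [div_mul_div_comm, div_mul_eq_mul_div, one_le_div (by positivity)]
  nlinarith [mul_le_mul h2 h3.le hfu'.le (by positivity)]

/-! ### Difference quotients in `B(e)` -/

/-- Away from `w` the quotient `g / e` is dominated by `f / e` and `1 / (z + i)`, because `s_β / e`
is bounded; near `w` it is bounded, unless `w` is a real zero of `e`, where `g = 0`. -/
theorem memHardyTwo_quotient {f g : ℂ → ℂ} (hf : f ∈ e.carrier) (t : ℝ) (w : ℂ)
    (hg : Differentiable ℂ g)
    (h : ∀ z, (z - w) * g z = e.assoc t w * f z - e.assoc t z * f w) :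
    MemHardyTwo (fun z => g z / e z) := by
  have hdiff : DifferentiableOn ℂ (fun z => g z / e z) {z : ℂ | 0 < z.im} := fun z hz =>
    ((hg z).div (e.differentiable' z) (e.ne_zero_of_im_pos hz)).differentiableWithinAt
  by_cases hcase : w.im = 0 ∧ e w = 0
  · -- at a real zero of `e` the numerator vanishes identically
    obtain ⟨hw, hew⟩ := hcase
    have hwr : (w.re : ℂ) = w := by
      apply Complex.ext <;> simp [hw]
    have hfw : f w = 0 := by
      rw [← hwr] at hew ⊢
      exact apply_eq_zero_of_zero hf hew
    have haw : e.assoc t w = 0 := by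
      have := e.norm_assoc_le t hw.ge
      rw [hew, norm_zero, mul_zero] at this
      exact norm_le_zero_iff.1 this
    have hz0 : ∀ z : ℂ, 0 < z.im → g z / e z = 0 := by
      intro z hz
      have h1 := h z
      rw [hfw, haw, zero_mul, mul_zero, sub_zero, mul_eq_zero] at h1
      rcases h1 with h1 | h1
      · rw [sub_eq_zero.1 h1, hw] at hz
        exact absurd hz (lt_irrefl _)
      · rw [h1, zero_div]
    exact MemHardyTwo.of_norm_le MemHardyTwo.zero MemHardyTwo.zero hdiff fun z hz => by
      simp [hz0 z hz]
  obtain ⟨r, hr, C, hC0, hC⟩ : ∃ r > 0, ∃ C : ℝ, 0 ≤ C ∧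
      ∀ z : ℂ, 0 < z.im → ‖z - w‖ < r → ‖g z / e z‖ ≤ C := by
    rcases lt_or_ge w.im 0 with hw | hw
    · refine ⟨-w.im, by linarith, 0, le_rfl, fun z hz hzw => ?_⟩
      have h1 := (le_abs_self _).trans_lt ((abs_im_le_norm (z - w)).trans_lt hzw)
      rw [sub_im] at h1
      linarith
    · have hew : e w ≠ 0 := by
        rcases hw.lt_or_eq with hw | hw
        · exact e.ne_zero_of_im_pos hw
        · exact fun h0 => hcase ⟨hw.symm, h0⟩
      have hc : ContinuousAt (fun z => ‖g z / e z‖) w :=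
        (hg.continuous.continuousAt.div e.differentiable'.continuous.continuousAt hew).norm
      have hev := hc.eventually_lt_const (lt_add_one ‖g w / e w‖)
      obtain ⟨r, hr, hb⟩ := Metric.eventually_nhds_iff.1 hev
      exact ⟨r, hr, ‖g w / e w‖ + 1, by positivity, fun z _ hz =>
        (hb (by rwa [dist_eq_norm])).le⟩
  set K : ℝ := C * (r + ‖w + I‖) + (1 + |t|) * ‖f w‖ * (1 + ‖w + I‖ / r) with hK
  have hK0 : 0 ≤ K := by positivity
  refine MemHardyTwo.of_norm_le (hf.2.1.const_mul ((‖e.assoc t w‖ / r : ℝ) : ℂ))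
    ((memHardyTwo_inv_add_mul_I one_pos).const_mul (K : ℂ)) hdiff fun z hz => ?_
  have hpos : 0 < ‖z + I‖ := by
    rw [norm_pos_iff]
    intro h0
    have := congrArg im h0
    simp at this
    linarith
  have htri : ‖z + I‖ ≤ ‖z - w‖ + ‖w + I‖ := by
    have : z + I = (z - w) + (w + I) := by ring
    rw [this]
    exact norm_add_le _ _
  have he : 0 < ‖e z‖ := norm_pos_iff.2 (e.ne_zero_of_im_pos hz)
  rw [ofReal_one, one_mul, norm_mul, norm_mul, norm_real, norm_real, Real.norm_of_nonneg hK0,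
    Real.norm_of_nonneg (by positivity), norm_inv, ← div_eq_mul_inv]
  rcases lt_or_ge ‖z - w‖ r with hlt | hge
  · have h1 : C ≤ K / ‖z + I‖ := by
      rw [le_div_iff₀ hpos, hK]
      have h2 : C * ‖z + I‖ ≤ C * (r + ‖w + I‖) := by gcongr; linarith
      have h3 : 0 ≤ (1 + |t|) * ‖f w‖ * (1 + ‖w + I‖ / r) := by positivity
      linarith
    have h4 : 0 ≤ ‖e.assoc t w‖ / r * ‖f z / e z‖ := by positivity
    linarith [hC z hz hlt]
  · have hzw : 0 < ‖z - w‖ := hr.trans_le hge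
    have hg' : ‖g z / e z‖ = ‖e.assoc t w * f z - e.assoc t z * f w‖ / (‖z - w‖ * ‖e z‖) := by
      rw [← h z, norm_mul, norm_div, mul_div_mul_left _ _ hzw.ne']
    have hinv : ‖z - w‖⁻¹ ≤ (1 + ‖w + I‖ / r) / ‖z + I‖ := by
      rw [inv_eq_one_div, div_le_div_iff₀ hzw hpos, one_mul]
      refine htri.trans ?_
      rw [add_mul, one_mul]
      gcongr
      rw [div_mul_eq_mul_div, le_div_iff₀ hr]
      gcongr
    have ha := e.norm_assoc_le t hz.le
    calc ‖g z / e z‖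
        ≤ (‖e.assoc t w‖ * ‖f z‖ + (1 + |t|) * ‖e z‖ * ‖f w‖) / (‖z - w‖ * ‖e z‖) := by
          rw [hg']
          gcongr
          refine (norm_sub_le _ _).trans ?_
          rw [norm_mul, norm_mul]
          gcongr
      _ = ‖e.assoc t w‖ / ‖z - w‖ * ‖f z / e z‖ + (1 + |t|) * ‖f w‖ * ‖z - w‖⁻¹ := by
          rw [norm_div]
          field_simp
      _ ≤ ‖e.assoc t w‖ / r * ‖f z / e z‖ +
            (1 + |t|) * ‖f w‖ * ((1 + ‖w + I‖ / r) / ‖z + I‖) := by gcongr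
      _ ≤ ‖e.assoc t w‖ / r * ‖f z / e z‖ + K / ‖z + I‖ := by
          gcongr
          rw [← mul_div_assoc, hK]
          gcongr
          have : 0 ≤ C * (r + ‖w + I‖) := by positivity
          linarith

/-- The quotients in the definition of `dom S_β` belong to `B(e)`. -/
theorem quotient_mem {f g : ℂ → ℂ} (hf : f ∈ e.carrier) (t : ℝ) (w : ℂ)
    (hg : Differentiable ℂ g)
    (h : ∀ z, (z - w) * g z = e.assoc t w * f z - e.assoc t z * f w) : g ∈ e.carrier := by
  refine ⟨hg, memHardyTwo_quotient hf t w hg h,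
    memHardyTwo_quotient (sharp_mem hf) t (conj w) hg.sharp fun z => ?_⟩
  have h1 := congrArg conj (h (conj z))
  simp only [map_mul, map_sub, conj_conj, assoc_conj] at h1
  simp only [sharp, conj_conj, assoc_conj]
  exact h1

/-- The quotients in the definition of `dom S_β` exist. -/
theorem exists_quotient {f : ℂ → ℂ} (hf : f ∈ e.carrier) (t : ℝ) (w : ℂ) :
    ∃ g ∈ e.carrier, ∀ z, (z - w) * g z = e.assoc t w * f z - e.assoc t z * f w := by
  set N : ℂ → ℂ := fun z => e.assoc t w * f z - e.assoc t z * f w with hN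
  have hNd : Differentiable ℂ N :=
    (hf.1.const_mul _).sub ((e.differentiable_assoc t).mul_const _)
  have hd : Differentiable ℂ (dslope N w) := by
    rw [← differentiableOn_univ] at hNd ⊢
    exact (Complex.differentiableOn_dslope univ_mem).2 hNd
  have h : ∀ z, (z - w) * dslope N w z = e.assoc t w * f z - e.assoc t z * f w := by
    intro z
    have h1 := sub_smul_dslope N w z
    have h2 : N w = 0 := by simp [hN]
    rw [h2, sub_zero, smul_eq_mul] at h1
    exact h1
  exact ⟨_, quotient_mem hf t w hd h, h⟩

/-! ### The boundary form of multiplication by the variable -/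

/-- The factor `R i / (x + R i)` is bounded by `1` and tends to `1` as `R → ∞`. -/
theorem tendsto_integral_mul_regularizer {Q : ℝ → ℂ} (hQ : Integrable Q) :
    Tendsto (fun R : ℝ => ∫ x : ℝ, Q x * (R * I * ((x : ℂ) + R * I)⁻¹)) atTop
      (𝓝 (∫ x : ℝ, Q x)) := by
  refine tendsto_integral_filter_of_dominated_convergence (fun x => ‖Q x‖) ?_ ?_ hQ.norm ?_
  · filter_upwards [eventually_gt_atTop 0] with R hR
    exact hQ.1.mul ((memLp_inv_add_mul_I hR.ne').const_mul _).1
  · filter_upwards [eventually_gt_atTop 0] with R hR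
    refine Eventually.of_forall fun x => ?_
    rw [norm_mul]
    refine mul_le_of_le_one_right (norm_nonneg _) ?_
    have h1 : ‖(R : ℂ) * I‖ = R := by simp [abs_of_pos hR]
    rw [norm_mul, norm_inv, h1, ← div_eq_mul_inv]
    refine div_le_one_of_le₀ ?_ (norm_nonneg _)
    refine le_of_sq_le_sq ?_ (norm_nonneg _)
    rw [norm_ofReal_add_mul_I_sq]
    nlinarith [sq_nonneg x]
  · refine Eventually.of_forall fun x => ?_
    have h1 : Tendsto (fun R : ℝ => ((R : ℂ))⁻¹) atTop (𝓝 0) := by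
      have := (continuous_ofReal.tendsto 0).comp tendsto_inv_atTop_zero
      simpa [Function.comp_def] using this
    have h2 : Tendsto (fun R : ℝ => I * ((x : ℂ) * (R : ℂ)⁻¹ + I)⁻¹) atTop (𝓝 1) := by
      have := (((h1.const_mul (x : ℂ)).add_const I).inv₀ (by simp)).const_mul I
      simpa using this
    have h3 : Tendsto (fun R : ℝ => R * I * ((x : ℂ) + R * I)⁻¹) atTop (𝓝 1) := by
      refine h2.congr' ?_
      filter_upwards [eventually_gt_atTop 0] with R hR
      have hRc : (R : ℂ) ≠ 0 := ofReal_ne_zero.2 hR.ne'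
      have h4 := ofReal_add_mul_I_ne_zero x hR.ne'
      have h5 : (x : ℂ) * (R : ℂ)⁻¹ + I = (x + R * I) * (R : ℂ)⁻¹ := by
        field_simp
      rw [h5, mul_inv, inv_inv]
      ring
    simpa using h3.const_mul (Q x)

/-- If `g` and `z g + c s_{π/2}` belong to `B(e)`, then `g / e` behaves like `c / z` along the
imaginary axis; here `s_0 ∈ B(e)` is used. -/
theorem tendsto_mul_div (h0 : e.s 0 ∈ e.carrier) {g h : ℂ → ℂ} (hh : h ∈ e.carrier) {c : ℂ}
    (hgh : ∀ z, h z = z * g z + c * e.assoc 0 z) :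
    Tendsto (fun R : ℝ => (R : ℂ) * (g (R * I) / e (R * I))) atTop (𝓝 (-I * c)) := by
  have hk : (h + (I * c) • e.s 0) ∈ e.carrier := e.carrier.add_mem hh (e.carrier.smul_mem _ h0)
  have hk0 : Tendsto (fun R : ℝ => (h + (I * c) • e.s 0) (R * I) / e (R * I)) atTop (𝓝 0) := by
    have h1 := (hardyBoundary_div hk).tendsto_sqrt_mul
    rw [tendsto_zero_iff_norm_tendsto_zero] at h1 ⊢
    refine squeeze_zero' (Eventually.of_forall fun R => norm_nonneg _) ?_ h1
    filter_upwards [eventually_ge_atTop 1] with R hR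
    rw [norm_mul, norm_real, Real.norm_of_nonneg (Real.sqrt_nonneg _)]
    exact le_mul_of_one_le_left (norm_nonneg _) (Real.one_le_sqrt.2 hR)
  have h2 := (hk0.const_add c).const_mul (-I)
  rw [add_zero] at h2
  refine h2.congr' ?_
  filter_upwards [eventually_gt_atTop 0] with R hR
  have he : e (R * I) ≠ 0 := e.ne_zero_of_im_pos (by simpa using hR)
  have h3 := hgh (R * I)
  simp only [Pi.add_apply, Pi.smul_apply, smul_eq_mul]
  rw [h3, assoc_zero, s_zero]
  generalize g (R * I) = a, sharp e (R * I) = d at *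
  generalize e (R * I) = b at *
  field_simp
  linear_combination (-2 * a * R - I * c * (b - d)) * I_sq

theorem sharp_relation {g h : ℂ → ℂ} {c : ℂ} (hgh : ∀ z, h z = z * g z + c * e.assoc 0 z) (z : ℂ) :
    sharp h z = z * sharp g z + conj c * e.assoc 0 z := by
  simp [sharp, hgh, assoc_conj]

/-- The regularized integrals of `a g / e + b g / e^#` over the real line; the second summand is
written as `b` times the conjugate of `g^# / e`.  The function `g / e` contributes nothing, as it
is in `H_2` and the pole of the regularizing factor lies in the lower half-plane. -/
theorem tendsto_regularized_integral (h0 : e.s 0 ∈ e.carrier) {g h : ℂ → ℂ} (hg : g ∈ e.carrier)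
    (hh : h ∈ e.carrier) {c : ℂ} (hgh : ∀ z, h z = z * g z + c * e.assoc 0 z) (a b : ℂ) :
    Tendsto (fun R : ℝ => ∫ x : ℝ, (a * (g x / e x) + b * conj (sharp g x / e x)) *
      (R * I * ((x : ℂ) + R * I)⁻¹)) atTop (𝓝 (2 * Real.pi * I * b * c)) := by
  have hlim := tendsto_mul_div h0 (sharp_mem hh) (sharp_relation hgh)
  have hlim2 := ((continuous_conj.tendsto _).comp hlim).const_mul (2 * Real.pi * b)
  have e1 : 2 * Real.pi * b * conj (-I * conj c) = 2 * Real.pi * I * b * c := by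
    simp
    ring
  rw [e1] at hlim2
  refine hlim2.congr' ?_
  filter_upwards [eventually_gt_atTop 0] with R hR
  have hG := hardyBoundary_div hg
  have hG2 := hardyBoundary_div (sharp_mem hg)
  have hsplit : ∀ x : ℝ, (a * (g x / e x) + b * conj (sharp g x / e x)) *
      (R * I * ((x : ℂ) + R * I)⁻¹) = (a * (R * I)) * (g x / e x * ((x : ℂ) + R * I)⁻¹) +
        (b * (R * I)) * conj (sharp g x / e x * ((x : ℂ) - R * I)⁻¹) := by
    intro x
    simp only [map_mul, map_inv₀, map_sub, conj_ofReal, conj_I]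
    ring
  simp only [hsplit]
  have i1 := (integrable_mul_of_memLp_two hG.memLp (memLp_inv_add_mul_I hR.ne')).const_mul
    (a * (R * I))
  have i2 : Integrable fun x : ℝ =>
      (b * (R * I)) * conj (sharp g x / e x * ((x : ℂ) - R * I)⁻¹) :=
    ((conjCLE : ℂ →L[ℝ] ℂ).integrable_comp
      (integrable_mul_of_memLp_two hG2.memLp (memLp_inv_sub_mul_I hR.ne'))).const_mul _
  rw [integral_add i1 i2, integral_const_mul, integral_const_mul, integral_conj,
    hG.integral_mul_inv_add hR, hG2.integral_mul_inv_sub hR]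
  simp only [Function.comp_apply, map_mul, conj_ofReal, conj_I, map_ofNat, mul_zero, zero_add]
  linear_combination (2 * Real.pi * b * R * conj (sharp g (R * I) / e (R * I))) * I_sq

/-- On the elements `g` of `B(e)` for which `z g + c s_{π/2}` belongs to `B(e)`, the number `c` is a
multiple of the inner product with `s_0`. -/
theorem inner_s_zero (h0 : e.s 0 ∈ e.carrier) (g h : e.Space) {c : ℂ}
    (hgh : ∀ z, h z = z * g z + c * e.assoc 0 z) :
    inner ℂ (Space.mk (e.s 0) h0) g = -Real.pi * c := by
  have h1 := tendsto_regularized_integral h0 g.mem h.mem hgh (-I / 2) (I / 2)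
  have h2 := tendsto_integral_mul_regularizer (integrable_integrand (Space.mk (e.s 0) h0) g)
  rw [← inner_def] at h2
  have h3 : 2 * Real.pi * I * (I / 2) * c = -Real.pi * c := by
    linear_combination Real.pi * c * I_sq
  rw [h3] at h1
  refine tendsto_nhds_unique h2 (h1.congr fun R => integral_congr_ae ?_)
  filter_upwards [e.ae_ne_zero] with x hx
  congr 1
  have hx' : conj (e x) ≠ 0 := (map_ne_zero _).2 hx
  rw [sharp_ofReal, Space.mk_apply, s_zero, sharp_ofReal, ← Complex.mul_conj']
  simp only [map_div₀, conj_conj, map_mul, map_sub, conj_I, map_ofNat]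
  field_simp
  ring

/-- Multiplication by the variable, corrected by a multiple of `s_{π/2}`, is symmetric. -/
theorem inner_mul_add_assoc (h0 : e.s 0 ∈ e.carrier) (g₁ h₁ g₂ h₂ : e.Space) {c₁ c₂ : ℂ}
    (hgh₁ : ∀ z, h₁ z = z * g₁ z + c₁ * e.assoc 0 z)
    (hgh₂ : ∀ z, h₂ z = z * g₂ z + c₂ * e.assoc 0 z) :
    inner ℂ h₁ g₂ = inner ℂ g₁ h₂ := by
  have l1 := (tendsto_regularized_integral h0 g₂.mem h₂.mem hgh₂ (-1 / 2) (-1 / 2)).const_mul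
    (conj c₁)
  have l2 := (tendsto_regularized_integral h0 (sharp_mem g₁.mem) (sharp_mem h₁.mem)
    (sharp_relation hgh₁) (-1 / 2) (-1 / 2)).const_mul c₂
  have l3 := l1.sub l2
  have hz : conj c₁ * (2 * Real.pi * I * (-1 / 2) * c₂) -
      c₂ * (2 * Real.pi * I * (-1 / 2) * conj c₁) = 0 := by ring
  rw [hz] at l3
  have hint := (integrable_integrand h₁ g₂).sub (integrable_integrand g₁ h₂)
  have l4 := tendsto_integral_mul_regularizer hint
  have hi := integral_sub (integrable_integrand h₁ g₂) (integrable_integrand g₁ h₂)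
  simp only [Pi.sub_apply] at l4
  rw [hi, ← inner_def, ← inner_def] at l4
  rw [← sub_eq_zero]
  refine tendsto_nhds_unique l4 (l3.congr' ?_)
  filter_upwards [eventually_gt_atTop 0] with R hR
  have hreg : MemLp (fun x : ℝ => R * I * ((x : ℂ) + R * I)⁻¹) 2 volume :=
    (memLp_inv_add_mul_I hR.ne').const_mul _
  have hi1 : ∀ f ∈ e.carrier, Integrable fun x : ℝ =>
      (-1 / 2 * (f x / e x) + -1 / 2 * conj (sharp f x / e x)) *
        (R * I * ((x : ℂ) + R * I)⁻¹) := by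
    intro f hf
    refine integrable_mul_of_memLp_two (MemLp.add ((hardyBoundary_div hf).memLp.const_mul _)
      (MemLp.const_mul (MemLp.star (hardyBoundary_div (sharp_mem hf)).memLp) _)) hreg
  rw [← integral_const_mul, ← integral_const_mul,
    ← integral_sub ((hi1 _ g₂.mem).const_mul _) ((hi1 _ (sharp_mem g₁.mem)).const_mul _)]
  refine integral_congr_ae ?_
  filter_upwards [e.ae_ne_zero] with x hx
  have hx' : conj (e x) ≠ 0 := (map_ne_zero _).2 hx
  simp only [hgh₁, hgh₂, sharp_ofReal, assoc_zero, ← Complex.mul_conj', map_add,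
    map_mul, map_div₀, map_neg, conj_conj, conj_ofReal, map_ofNat]
  generalize (R * I * ((x : ℂ) + R * I)⁻¹) = ρ
  field_simp
  ring

/-! ### The operators `S_β` -/

@[simp] theorem Space.sub_apply (f g : e.Space) (z : ℂ) : (f - g) z = f z - g z := rfl

/-- The coefficient `c` for which `z g + c s_{π/2}` can belong to `B(e)`. -/
def coeff (h0 : e.s 0 ∈ e.carrier) (g : e.Space) : ℂ :=
  -(inner ℂ (Space.mk (e.s 0) h0) g) / Real.pi

variable (h0 : e.s 0 ∈ e.carrier)

theorem coeff_add (f g : e.Space) : coeff h0 (f + g) = coeff h0 f + coeff h0 g := by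
  simp only [coeff, inner_add_right]
  ring

theorem coeff_smul (a : ℂ) (g : e.Space) : coeff h0 (a • g) = a * coeff h0 g := by
  simp only [coeff, inner_smul_right]
  ring

theorem inner_s_zero_eq_coeff (g : e.Space) :
    inner ℂ (Space.mk (e.s 0) h0) g = -Real.pi * coeff h0 g := by
  have : (Real.pi : ℂ) ≠ 0 := ofReal_ne_zero.2 Real.pi_ne_zero
  rw [coeff]
  field_simp

theorem inner_s_zero_right_eq_coeff (g : e.Space) :
    inner ℂ g (Space.mk (e.s 0) h0) = -Real.pi * conj (coeff h0 g) := by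
  rw [← inner_conj_symm, inner_s_zero_eq_coeff]
  simp

/-- The coefficient is the same for all the associated functions, as they differ by multiples of
`s_0 ∈ B(e)`. -/
theorem coeff_eq (t : ℝ) {g h : e.Space} {c : ℂ} (hgh : ∀ z, h z = z * g z + c * e.assoc t z) :
    coeff h0 g = c := by
  have h1 := inner_s_zero h0 g (h - (c * t) • Space.mk (e.s 0) h0) (c := c) fun z => by
    rw [Space.sub_apply, hgh, assoc_eq_add, Space.smul_apply, Space.mk_apply]
    ring
  have : (Real.pi : ℂ) ≠ 0 := ofReal_ne_zero.2 Real.pi_ne_zero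
  rw [coeff, h1]
  field_simp

/-- The selfadjoint extension of `S` with parameter `t = cot β`: it maps `g` to
`z g + c (s_{π/2} + t s_0)`, where `c` is the coefficient that makes this an element of `B(e)`. -/
def extOp (t : ℝ) : e.Space →ₗ.[ℂ] e.Space where
  domain :=
    { carrier := {g | ∃ h : e.Space, ∀ z, h z = z * g z + coeff h0 g * e.assoc 0 z}
      zero_mem' := ⟨0, fun z => by simp [coeff]⟩
      add_mem' := by
        rintro f g ⟨h, hh⟩ ⟨k, hk⟩
        refine ⟨h + k, fun z => ?_⟩
        rw [coeff_add, Space.add_apply, Space.add_apply, hh, hk]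
        ring
      smul_mem' := by
        rintro a f ⟨h, hh⟩
        refine ⟨a • h, fun z => ?_⟩
        rw [coeff_smul, Space.smul_apply, Space.smul_apply, hh]
        ring }
  toFun :=
    { toFun := fun g => Space.mk (fun z => z * g.1 z + coeff h0 g.1 * e.assoc t z) (by
        obtain ⟨h, hh⟩ := g.2
        have h1 := (h + (coeff h0 g.1 * t) • Space.mk (e.s 0) h0).mem
        convert h1 using 1
        funext z
        rw [Space.add_apply, hh, assoc_eq_add, Space.smul_apply, Space.mk_apply]
        ring)
      map_add' := by
        intro f g
        ext z
        simp only [Submodule.coe_add, Space.mk_apply, Space.add_apply, coeff_add]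
        ring
      map_smul' := by
        intro a f
        ext z
        simp only [Submodule.coe_smul, Space.mk_apply, Space.smul_apply, coeff_smul,
          RingHom.id_apply]
        ring }

theorem extOp_apply (t : ℝ) (g : (extOp h0 t).domain) (z : ℂ) :
    extOp h0 t g z = z * (g : e.Space) z + coeff h0 g * e.assoc t z := rfl

theorem mem_domain_extOp (t t' : ℝ) {g h : e.Space} {c : ℂ}
    (hgh : ∀ z, h z = z * g z + c * e.assoc t z) : g ∈ (extOp h0 t').domain := by
  refine ⟨h - (c * t) • Space.mk (e.s 0) h0, fun z => ?_⟩
  rw [coeff_eq h0 t hgh, Space.sub_apply, hgh, assoc_eq_add, Space.smul_apply, Space.mk_apply]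
  ring

theorem extOp_domain (t t' : ℝ) : (extOp h0 t).domain = (extOp h0 t').domain := rfl

theorem extOp_eq_add (t : ℝ) (g : (extOp h0 0).domain) :
    extOp h0 t ⟨g, g.2⟩ = extOp h0 0 g + (coeff h0 g * t) • Space.mk (e.s 0) h0 := by
  ext z
  rw [Space.add_apply, extOp_apply, extOp_apply, assoc_eq_add, Space.smul_apply, Space.mk_apply]
  ring

theorem extOp_symm (t : ℝ) (f g : (extOp h0 t).domain) :
    inner ℂ (extOp h0 t f) (g : e.Space) = inner ℂ (f : e.Space) (extOp h0 t g) := by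
  have h1 := inner_mul_add_assoc h0 (f : e.Space) (extOp h0 0 ⟨f, f.2⟩) (g : e.Space)
    (extOp h0 0 ⟨g, g.2⟩) (extOp_apply h0 0 _) (extOp_apply h0 0 _)
  have hf := extOp_eq_add h0 t ⟨f, f.2⟩
  have hg := extOp_eq_add h0 t ⟨g, g.2⟩
  change extOp h0 t f = _ at hf
  change extOp h0 t g = _ at hg
  rw [hf, hg, inner_add_left, inner_add_right, h1, inner_smul_left, inner_smul_right,
    inner_s_zero_eq_coeff, inner_s_zero_right_eq_coeff, map_mul, conj_ofReal]
  ring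

/-- The resolvent equation can be solved at every point that is not a zero of the associated
function. -/
theorem exists_extOp_sub_smul_eq (t : ℝ) {w : ℂ} (hw : e.assoc t w ≠ 0) (f : e.Space) :
    ∃ g : (extOp h0 t).domain, extOp h0 t g - w • (g : e.Space) = f := by
  obtain ⟨q, hq, hqe⟩ := exists_quotient f.mem t w
  obtain ⟨g, hg⟩ : ∃ g : e.Space, g = (e.assoc t w)⁻¹ • Space.mk q hq := ⟨_, rfl⟩
  have hgz : ∀ z, (z - w) * g z = f z - (e.assoc t w)⁻¹ * f w * e.assoc t z := by
    intro z
    rw [hg, Space.smul_apply, Space.mk_apply, mul_left_comm, hqe]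
    field_simp
  have hgh : ∀ z, (f + w • g) z = z * g z + (e.assoc t w)⁻¹ * f w * e.assoc t z := by
    intro z
    rw [Space.add_apply, Space.smul_apply]
    linear_combination -hgz z
  refine ⟨⟨g, mem_domain_extOp h0 t t hgh⟩, ?_⟩
  ext z
  rw [Space.sub_apply, extOp_apply, Space.smul_apply, coeff_eq h0 t hgh]
  linear_combination hgz z

theorem inner_extOp_sub_smul (t : ℝ) (w : ℂ) (f g : (extOp h0 t).domain) :
    inner ℂ (extOp h0 t f - conj w • (f : e.Space)) (g : e.Space) =
      inner ℂ (f : e.Space) (extOp h0 t g - w • (g : e.Space)) := by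
  rw [inner_sub_left, inner_sub_right, inner_smul_left, inner_smul_right, extOp_symm, conj_conj]

/-- Only zero is orthogonal to the range of `S_β - w`, for nonreal `w`. -/
theorem eq_zero_of_inner_extOp (t : ℝ) {w : ℂ} (hw : e.assoc t w ≠ 0) {u : e.Space}
    (hu : ∀ g : (extOp h0 t).domain, inner ℂ (extOp h0 t g - w • (g : e.Space)) u = 0) :
    u = 0 := by
  obtain ⟨g, hg⟩ := exists_extOp_sub_smul_eq h0 t hw u
  have := hu g
  rw [hg] at this
  exact inner_self_eq_zero.1 this

/-! ### Density of the domain -/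

theorem norm_sq_eq_integral (f : e.Space) : ‖f‖ ^ 2 = ∫ x : ℝ, ‖f x / e x‖ ^ 2 := by
  have h1 : (fun x : ℝ => conj (f x) * f x / (‖e x‖ : ℂ) ^ 2) =
      fun x : ℝ => ((‖f x / e x‖ ^ 2 : ℝ) : ℂ) := by
    funext x
    rw [integrand_eq, Complex.conj_mul']
    push_cast
    rfl
  have h2 := inner_self_eq_norm_sq_to_K (𝕜 := ℂ) f
  rw [inner_def, h1, integral_complex_ofReal] at h2
  have h3 := congrArg re h2
  rw [ofReal_re] at h3
  rw [h3]
  norm_cast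

theorem integrable_norm_div_sq (f : e.Space) : Integrable fun x : ℝ => ‖f x / e x‖ ^ 2 := by
  simpa using f.memLp.integrable_norm_pow (by norm_num)

/-- The error of the approximation of `f` by `-w (S_{π/2} - w)⁻¹ f`, `w = R i`. -/
theorem norm_add_smul_sq_le {f : e.Space} {R : ℝ} (hR : 0 < R) (g : (extOp h0 0).domain)
    (hg : extOp h0 0 g - (R * I) • (g : e.Space) = f) :
    ‖f + (R * I : ℂ) • (g : e.Space)‖ ^ 2 ≤
      2 * (∫ x : ℝ, ‖f x / e x‖ ^ 2 * (x ^ 2 * (x ^ 2 + R ^ 2)⁻¹)) +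
        2 * Real.pi * (R * ‖coeff h0 g‖ ^ 2) := by
  have hi1 : Integrable fun x : ℝ => ‖f x / e x‖ ^ 2 * (x ^ 2 * (x ^ 2 + R ^ 2)⁻¹) := by
    refine (integrable_norm_div_sq f).mul_bdd (c := 1) ?_ (Eventually.of_forall fun x => ?_)
    · exact ((measurable_id.pow_const 2).mul
        ((measurable_id.pow_const 2).add_const _).inv).aestronglyMeasurable
    · rw [Real.norm_of_nonneg (by positivity), ← div_eq_mul_inv]
      refine div_le_one_of_le₀ ?_ (by positivity)
      nlinarith
  have hi2 := (integrable_inv_sq_add_sq hR).const_mul (2 * (R ^ 2 * ‖coeff h0 g‖ ^ 2))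
  have h1 : ∫ x : ℝ, (2 * (‖f x / e x‖ ^ 2 * (x ^ 2 * (x ^ 2 + R ^ 2)⁻¹)) +
      2 * (R ^ 2 * ‖coeff h0 g‖ ^ 2) * (x ^ 2 + R ^ 2)⁻¹) =
      2 * (∫ x : ℝ, ‖f x / e x‖ ^ 2 * (x ^ 2 * (x ^ 2 + R ^ 2)⁻¹)) +
        2 * Real.pi * (R * ‖coeff h0 g‖ ^ 2) := by
    rw [integral_add (hi1.const_mul 2) hi2, integral_const_mul, integral_const_mul,
      integral_univ_inv_sq_add_sq hR]
    field_simp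
  rw [← h1, norm_sq_eq_integral]
  refine integral_mono_ae (integrable_norm_div_sq _) ((hi1.const_mul 2).add hi2) ?_
  filter_upwards [e.ae_ne_zero] with x hx
  have hxw := ofReal_sub_mul_I_ne_zero x hR.ne'
  -- `(x - w) g = f - c s_{π/2}`, and so `(x - w) (f + w g) = x f - w c s_{π/2}`
  have hz : ((x : ℂ) - R * I) * (f + (R * I : ℂ) • (g : e.Space)) x =
      x * f x - R * I * coeff h0 g * e.assoc 0 x := by
    rw [← hg]
    simp only [Space.add_apply, Space.smul_apply, Space.sub_apply, extOp_apply]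
    ring
  have hz2 : (f + (R * I : ℂ) • (g : e.Space)) x / e x =
      (x * (f x / e x) - R * I * coeff h0 g * (e.assoc 0 x / e x)) / ((x : ℂ) - R * I) := by
    rw [eq_div_iff hxw, div_mul_eq_mul_div, mul_comm, hz]
    ring
  have hp : ‖e.assoc 0 x / e x‖ ≤ 1 := by
    rw [norm_div]
    refine div_le_one_of_le₀ ?_ (norm_nonneg _)
    simpa using e.norm_assoc_le 0 (z := x) (by simp)
  have hn : ‖x * (f x / e x) - R * I * coeff h0 g * (e.assoc 0 x / e x)‖ ≤
      |x| * ‖f x / e x‖ + R * ‖coeff h0 g‖ := by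
    refine (norm_sub_le _ _).trans ?_
    rw [norm_mul, norm_mul, norm_mul, norm_mul, norm_I, norm_real, norm_real, mul_one,
      Real.norm_of_nonneg hR.le, Real.norm_eq_abs]
    exact add_le_add le_rfl (mul_le_of_le_one_right (by positivity) hp)
  rw [hz2, norm_div, div_pow, norm_ofReal_sub_mul_I_sq, div_eq_mul_inv]
  have h3 : ‖x * (f x / e x) - R * I * coeff h0 g * (e.assoc 0 x / e x)‖ ^ 2 ≤
      2 * (‖f x / e x‖ ^ 2 * x ^ 2) + 2 * (R ^ 2 * ‖coeff h0 g‖ ^ 2) := by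
    calc _ ≤ (|x| * ‖f x / e x‖ + R * ‖coeff h0 g‖) ^ 2 := by gcongr
      _ ≤ 2 * (|x| * ‖f x / e x‖) ^ 2 + 2 * (R * ‖coeff h0 g‖) ^ 2 := by
        nlinarith [sq_nonneg (|x| * ‖f x / e x‖ - R * ‖coeff h0 g‖)]
      _ = _ := by
        rw [mul_pow, mul_pow, sq_abs]
        ring
  calc _ ≤ (2 * (‖f x / e x‖ ^ 2 * x ^ 2) + 2 * (R ^ 2 * ‖coeff h0 g‖ ^ 2)) *
        (x ^ 2 + R ^ 2)⁻¹ := by gcongr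
    _ = _ := by ring

theorem tendsto_integral_sq_mul (f : e.Space) :
    Tendsto (fun R : ℝ => ∫ x : ℝ, ‖f x / e x‖ ^ 2 * (x ^ 2 * (x ^ 2 + R ^ 2)⁻¹)) atTop (𝓝 0) := by
  have hf := integrable_norm_div_sq f
  have h1 := tendsto_integral_filter_of_dominated_convergence (μ := (volume : Measure ℝ))
    (l := (atTop : Filter ℝ))
    (F := fun R x => ‖f x / e x‖ ^ 2 * (x ^ 2 * (x ^ 2 + R ^ 2)⁻¹)) (f := fun _ => 0)
    (fun x : ℝ => ‖f x / e x‖ ^ 2) ?_ ?_ hf ?_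
  · simpa using h1
  · exact Eventually.of_forall fun R => hf.1.mul ((measurable_id.pow_const 2).mul
      ((measurable_id.pow_const 2).add_const _).inv).aestronglyMeasurable
  · refine Eventually.of_forall fun R => Eventually.of_forall fun x => ?_
    rw [Real.norm_of_nonneg (by positivity)]
    refine mul_le_of_le_one_right (by positivity) ?_
    rw [← div_eq_mul_inv]
    refine div_le_one_of_le₀ ?_ (by positivity)
    nlinarith [sq_nonneg R]
  · refine Eventually.of_forall fun x => ?_
    have h2 : Tendsto (fun R : ℝ => (x ^ 2 + R ^ 2)⁻¹) atTop (𝓝 0) :=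
      tendsto_inv_atTop_zero.comp
        (tendsto_atTop_add_const_left _ _ (tendsto_pow_atTop two_ne_zero))
    simpa using (h2.const_mul (x ^ 2)).const_mul (‖f x / e x‖ ^ 2)

theorem tendsto_sqrt_mul_div_assoc (h0 : e.s 0 ∈ e.carrier) (f : e.Space) :
    Tendsto (fun R : ℝ => (√R : ℂ) * (f (R * I) / e.assoc 0 (R * I))) atTop (𝓝 0) := by
  have h1 := (hardyBoundary_div f.mem).tendsto_sqrt_mul
  have h2 : Tendsto (fun R : ℝ => e.s 0 (R * I) / e (R * I)) atTop (𝓝 0) := by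
    have h3 := (hardyBoundary_div h0).tendsto_sqrt_mul
    rw [tendsto_zero_iff_norm_tendsto_zero] at h3 ⊢
    refine squeeze_zero' (Eventually.of_forall fun R => norm_nonneg _) ?_ h3
    filter_upwards [eventually_ge_atTop 1] with R hR
    rw [norm_mul, norm_real, Real.norm_of_nonneg (Real.sqrt_nonneg _)]
    exact le_mul_of_one_le_left (norm_nonneg _) (Real.one_le_sqrt.2 hR)
  have h4 : Tendsto (fun R : ℝ => (-1 - I * (e.s 0 (R * I) / e (R * I)))⁻¹) atTop (𝓝 (-1)) := by
    have := ((h2.const_mul I).const_sub (-1)).inv₀ (by simp)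
    have h5 : (-1 - I * 0 : ℂ)⁻¹ = -1 := by norm_num
    rwa [h5] at this
  have h6 := h1.mul h4
  rw [zero_mul] at h6
  refine h6.congr' ?_
  filter_upwards [eventually_gt_atTop 0] with R hR
  have he : e (R * I) ≠ 0 := e.ne_zero_of_im_pos (by simpa using hR)
  have h7 : -1 - I * (e.s 0 (R * I) / e (R * I)) = e.assoc 0 (R * I) / e (R * I) := by
    rw [assoc_zero, s_zero]
    generalize e (R * I) = b at *
    generalize sharp e (R * I) = d
    field_simp
    linear_combination -(b - d) * I_sq
  rw [h7, inv_div, mul_assoc, div_mul_div_cancel₀ he]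

theorem dense_domain_extOp (t : ℝ) : Dense ((extOp h0 t).domain : Set e.Space) := by
  intro f
  have hex : ∀ R : ℝ, ∃ g : (extOp h0 0).domain, 0 < R →
      extOp h0 0 g - (R * I) • (g : e.Space) = f := by
    intro R
    by_cases hR : 0 < R
    · obtain ⟨g, hg⟩ := exists_extOp_sub_smul_eq h0 0
        (e.assoc_ne_zero 0 (z := R * I) (by simpa using hR)) f
      exact ⟨g, fun _ => hg⟩
    · exact ⟨0, fun h => absurd h hR⟩
  choose g hg using hex
  have hcoeff : ∀ R : ℝ, 0 < R →
      coeff h0 (g R) = f (R * I) / e.assoc 0 (R * I) := by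
    intro R hR
    rw [eq_div_iff (e.assoc_ne_zero 0 (by simpa using hR)), ← hg R hR]
    simp only [Space.sub_apply, Space.smul_apply, extOp_apply]
    ring
  have hlim : Tendsto (fun R : ℝ => -((R * I : ℂ) • (g R : e.Space))) atTop (𝓝 f) := by
    rw [tendsto_iff_norm_sub_tendsto_zero]
    have h1 : Tendsto (fun R : ℝ => ‖f + (R * I : ℂ) • (g R : e.Space)‖ ^ 2) atTop (𝓝 0) := by
      have h2 := ((tendsto_integral_sq_mul f).const_mul 2).add
        (((tendsto_sqrt_mul_div_assoc h0 f).norm.pow 2).const_mul (2 * Real.pi))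
      simp only [mul_zero, norm_zero, zero_pow two_ne_zero, add_zero] at h2
      refine squeeze_zero' (Eventually.of_forall fun R => sq_nonneg _) ?_ h2
      filter_upwards [eventually_gt_atTop 0] with R hR
      refine (norm_add_smul_sq_le h0 hR (g R) (hg R hR)).trans_eq ?_
      rw [hcoeff R hR, norm_mul, mul_pow, norm_real, Real.norm_of_nonneg (Real.sqrt_nonneg _),
        Real.sq_sqrt hR.le]
    have h3 := h1.sqrt
    simp only [Real.sqrt_sq (norm_nonneg _), Real.sqrt_zero] at h3
    refine h3.congr fun R => ?_
    rw [← norm_neg]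
    congr 1
    abel
  refine mem_closure_of_tendsto hlim (Eventually.of_forall fun R => ?_)
  exact (extOp h0 0).domain.neg_mem ((extOp h0 0).domain.smul_mem _ (g R).2)

/-! ### Selfadjointness and classification -/

theorem extOp_isSelfadjointOp (t : ℝ) : e.IsSelfadjointOp (extOp h0 t) := by
  refine ⟨dense_domain_extOp h0 t, le_antisymm ?_ ?_⟩
  · rintro ⟨y, y'⟩ hy
    rw [Submodule.mem_adjoint_iff] at hy
    obtain ⟨g, hg⟩ := exists_extOp_sub_smul_eq h0 t (w := I) (e.assoc_ne_zero t (by simp))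
      (y' - I • y)
    -- `y - g` is orthogonal to the range of `S_β + i`
    have hu : y - g = 0 := by
      refine eq_zero_of_inner_extOp h0 t (w := conj I)
        (e.assoc_ne_zero_of_im_neg t (by simp)) fun x => ?_
      have h1 := hy x (extOp h0 t x) (by simp)
      have h2 := inner_extOp_sub_smul h0 t I x g
      rw [hg] at h2
      rw [inner_sub_right, h2, inner_sub_left, inner_sub_right, inner_smul_left, inner_smul_right,
        conj_conj]
      linear_combination h1
    have hyg : y = g := sub_eq_zero.1 hu
    rw [LinearPMap.mem_graph_iff]
    refine ⟨g, hyg.symm, ?_⟩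
    rw [← hyg] at hg
    simpa using hg
  · rintro ⟨y, y'⟩ hy
    rw [LinearPMap.mem_graph_iff] at hy
    obtain ⟨g, rfl, rfl⟩ := hy
    rw [Submodule.mem_adjoint_iff]
    intro a b hab
    rw [LinearPMap.mem_graph_iff] at hab
    obtain ⟨x, rfl, rfl⟩ := hab
    rw [sub_eq_zero]
    exact extOp_symm h0 t x g

theorem mulOp_le_extOp (t : ℝ) : e.mulOp ≤ extOp h0 t := by
  have key : ∀ x : e.mulOp.domain, ∀ z, e.mulOp x z = z * (x : e.Space) z + 0 * e.assoc t z := by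
    intro x z
    rw [zero_mul, add_zero]
    rfl
  refine ⟨fun x hx => mem_domain_extOp h0 t t (key ⟨x, hx⟩), ?_⟩
  intro x y hxy
  ext z
  rw [extOp_apply, ← hxy, coeff_eq h0 t (key x), key]

theorem mem_domain_mulOp {t : ℝ} {g : e.Space} (hg : g ∈ (extOp h0 t).domain)
    (hc : coeff h0 g = 0) : g ∈ e.mulOp.domain := by
  have h := (extOp h0 t ⟨g, hg⟩).mem
  have h2 : (extOp h0 t ⟨g, hg⟩ : ℂ → ℂ) = fun z => z * g z := by
    funext z
    rw [extOp_apply, hc, zero_mul, add_zero]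
  rw [h2] at h
  exact h

theorem exists_coeff_ne_zero {K : Submodule ℂ e.Space} (hK : Dense (K : Set e.Space)) :
    ∃ y ∈ K, coeff h0 y ≠ 0 := by
  by_contra! h
  have h1 : Space.mk (e.s 0) h0 = 0 := by
    refine hK.eq_zero_of_inner_left (𝕜 := ℂ) fun v hv => ?_
    rw [inner_s_zero_eq_coeff, h v hv, mul_zero]
  refine e.s_zero_ne_zero (z := I) (by simp) ?_
  have := congrArg (fun f : e.Space => f I) h1
  simpa using this

/-- The adjoint relation of `S` consists of the pairs `(y, S_{π/2} y + d s_0)`: modulo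
`S_{π/2}`, an element of it gives a vector orthogonal to the range of `S + i`, and this range has
codimension one. -/
theorem exists_eq_extOp_add_of_adjoint {y y' : e.Space}
    (hy : ∀ x : e.mulOp.domain, inner ℂ (e.mulOp x) y = inner ℂ (x : e.Space) y') :
    ∃ (hyD : y ∈ (extOp h0 0).domain) (d : ℂ),
      y' = extOp h0 0 ⟨y, hyD⟩ + d • Space.mk (e.s 0) h0 := by
  set A := extOp h0 0 with hA
  set s₀ := Space.mk (e.s 0) h0 with hs₀
  have hpos : e.assoc 0 I ≠ 0 := e.assoc_ne_zero 0 (by simp)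
  have hneg : e.assoc 0 (conj I) ≠ 0 := e.assoc_ne_zero_of_im_neg 0 (by simp)
  obtain ⟨g, hg⟩ := exists_extOp_sub_smul_eq h0 0 hpos (y' - I • y)
  obtain ⟨ψ, hψ⟩ := exists_extOp_sub_smul_eq h0 0 hpos s₀
  obtain ⟨k, hk, hkc⟩ := exists_coeff_ne_zero h0 (dense_domain_extOp h0 0)
  have hψi : ∀ x : A.domain, inner ℂ (A x - conj I • (x : e.Space)) (ψ : e.Space) =
      -Real.pi * conj (coeff h0 x) := by
    intro x
    rw [inner_extOp_sub_smul, hψ, inner_s_zero_right_eq_coeff]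
  have hS : ∀ x : A.domain, coeff h0 x = 0 →
      inner ℂ (A x - conj I • (x : e.Space)) (y - g) = 0 := by
    intro x hx
    have h1 := hy ⟨x, mem_domain_mulOp h0 x.2 hx⟩
    have h2 : e.mulOp ⟨x, mem_domain_mulOp h0 x.2 hx⟩ = A x :=
      (mulOp_le_extOp h0 0).2 rfl
    have h3 := inner_extOp_sub_smul h0 0 I x g
    rw [hg] at h3
    rw [h2] at h1
    rw [inner_sub_right, h3, inner_sub_left, inner_sub_right, inner_smul_left, inner_smul_right,
      conj_conj, h1]
    ring
  -- subtracting a multiple of `k` from an element of the domain of `A` moves it into `dom S`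
  set L : ℂ := inner ℂ (A ⟨k, hk⟩ - conj I • k) (y - (g : e.Space)) with hL
  -- hence `y - g` and a multiple of `ψ` have the same inner products with the range of `A + i`
  have hall : ∀ x : A.domain, inner ℂ (A x - conj I • (x : e.Space)) (y - (g : e.Space)) =
      conj (coeff h0 x / coeff h0 k) * L := by
    intro x
    set a := coeff h0 x / coeff h0 k with ha
    have h1 := hS (x - a • ⟨k, hk⟩) (by
      have : ((x - a • ⟨k, hk⟩ : A.domain) : e.Space) = x + (-a) • k := by
        rw [neg_smul, ← sub_eq_add_neg]
        rfl
      rw [this, coeff_add, coeff_smul, ha]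
      field_simp
      ring)
    have h2 : A (x - a • ⟨k, hk⟩) - conj I • ((x - a • ⟨k, hk⟩ : A.domain) : e.Space) =
        (A x - conj I • (x : e.Space)) - a • (A ⟨k, hk⟩ - conj I • k) := by
      rw [LinearPMap.map_sub, LinearPMap.map_smul, Submodule.coe_sub, Submodule.coe_smul]
      module
    rw [h2, inner_sub_left, inner_smul_left] at h1
    exact sub_eq_zero.1 h1
  set l : ℂ := -L / (Real.pi * conj (coeff h0 k)) with hl
  have hkc' : conj (coeff h0 k) ≠ 0 := (map_ne_zero _).2 hkc
  have hpi : (Real.pi : ℂ) ≠ 0 := ofReal_ne_zero.2 Real.pi_ne_zero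
  have hu : y - g - l • (ψ : e.Space) = 0 := by
    refine eq_zero_of_inner_extOp h0 0 hneg fun x => ?_
    rw [inner_sub_right, hall, inner_smul_right, hψi, hl, map_div₀]
    field_simp
    ring
  have hyg : y = g + l • (ψ : e.Space) := by
    rw [sub_sub] at hu
    exact sub_eq_zero.1 hu
  have hyD : y ∈ A.domain := by
    rw [hyg]
    exact A.domain.add_mem g.2 (A.domain.smul_mem _ ψ.2)
  refine ⟨hyD, -l, ?_⟩
  have hAy : A ⟨y, hyD⟩ = A g + l • A ψ := by
    rw [← LinearPMap.map_smul, ← LinearPMap.map_add]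
    congr 1
    exact Subtype.ext hyg
  have hg' : A g = y' - I • y + I • (g : e.Space) := sub_eq_iff_eq_add.1 hg
  have hψ' : A ψ = s₀ + I • (ψ : e.Space) := sub_eq_iff_eq_add.1 hψ
  rw [hAy, hg', hψ']
  rw [hyg]
  module

/-- Every selfadjoint extension of `S` is one of the operators `S_β`. -/
theorem exists_eq_extOp {T : e.Space →ₗ.[ℂ] e.Space} (hST : e.mulOp ≤ T)
    (hT : e.IsSelfadjointOp T) : ∃ t : ℝ, extOp h0 t = T := by
  obtain ⟨hdense, hadj⟩ := hT
  have hsymm : ∀ x y : T.domain, inner ℂ (T x) (y : e.Space) = inner ℂ (x : e.Space) (T y) := by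
    intro x y
    have h1 : ((y : e.Space), T y) ∈ T.graph.adjoint := by
      rw [hadj]
      simp
    rw [Submodule.mem_adjoint_iff] at h1
    exact sub_eq_zero.1 (h1 x (T x) (by simp))
  have hform : ∀ y : T.domain, ∃ (hyD : (y : e.Space) ∈ (extOp h0 0).domain) (d : ℂ),
      T y = extOp h0 0 ⟨y, hyD⟩ + d • Space.mk (e.s 0) h0 := by
    intro y
    refine exists_eq_extOp_add_of_adjoint h0 fun x => ?_
    have h1 : e.mulOp x = T ⟨x, hST.1 x.2⟩ := hST.2 rfl
    rw [h1]
    exact hsymm _ y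
  choose hD d hd using hform
  have hrel : ∀ x y : T.domain, conj (d x) * coeff h0 y = d y * conj (coeff h0 x) := by
    intro x y
    have h1 := hsymm x y
    rw [hd x, hd y, inner_add_left, inner_add_right, inner_smul_left, inner_smul_right,
      inner_s_zero_eq_coeff, inner_s_zero_right_eq_coeff] at h1
    have h2 := extOp_symm h0 0 ⟨x, hD x⟩ ⟨y, hD y⟩
    have hpi : (Real.pi : ℂ) ≠ 0 := ofReal_ne_zero.2 Real.pi_ne_zero
    refine mul_left_cancel₀ hpi ?_
    linear_combination h2 - h1
  obtain ⟨y₁, hy₁, hc₁⟩ := exists_coeff_ne_zero h0 hdense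
  set p : T.domain := ⟨y₁, hy₁⟩ with hp
  have hc₁' : conj (coeff h0 y₁) ≠ 0 := (map_ne_zero _).2 hc₁
  obtain ⟨t, ht⟩ : ∃ t : ℝ, d p / coeff h0 y₁ = t := by
    have h1 : conj (d p / coeff h0 y₁) = d p / coeff h0 y₁ := by
      rw [map_div₀, div_eq_div_iff hc₁' hc₁]
      exact hrel p p
    exact ⟨_, (conj_eq_iff_re.1 h1).symm⟩
  have hdt : ∀ y : T.domain, d y = coeff h0 y * t := by
    intro y
    have h1 := hrel p y
    have h2 : conj (d p) = t * conj (coeff h0 y₁) := by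
      rw [div_eq_iff hc₁] at ht
      rw [ht, map_mul, conj_ofReal]
    rw [h2] at h1
    refine mul_right_cancel₀ hc₁' ?_
    linear_combination -h1
  have hle : T ≤ extOp h0 t := by
    refine ⟨fun y hy => hD ⟨y, hy⟩, fun x y hxy => ?_⟩
    have h1 := extOp_eq_add h0 t ⟨x, hD x⟩
    rw [hd x, hdt x, ← h1]
    congr 1
    exact Subtype.ext hxy
  refine ⟨t, le_antisymm (LinearPMap.le_of_le_graph ?_) hle⟩
  rintro ⟨y, y'⟩ hy
  rw [← (extOp_isSelfadjointOp h0 t).2, Submodule.mem_adjoint_iff] at hy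
  rw [← hadj, Submodule.mem_adjoint_iff]
  exact fun a b hab => hy a b (LinearPMap.le_graph_of_le hle hab)

/-! ### The description of the operators by quotients -/

theorem isQuotient_iff {β : ℝ} (hβ : Real.sin β ≠ 0) (w : ℂ) (f g : ℂ → ℂ) :
    e.IsQuotient β w f g ↔ Differentiable ℂ g ∧
      ∀ z, (z - w) * g z = e.assoc (Real.cot β) w * f z - e.assoc (Real.cot β) z * f w := by
  have hβ' : (Real.sin β : ℂ) ≠ 0 := ofReal_ne_zero.2 hβ
  refine and_congr_right fun _ => ⟨fun h z => ?_, fun h z hz => ?_⟩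
  · by_cases hz : z = w
    · rw [hz, sub_self, zero_mul, sub_self]
    · have hz' := sub_ne_zero.2 hz
      rw [h z hz, e.s_eq_sin_mul_assoc hβ, e.s_eq_sin_mul_assoc hβ]
      field_simp
  · have hz' := sub_ne_zero.2 hz
    rw [e.s_eq_sin_mul_assoc hβ, e.s_eq_sin_mul_assoc hβ, eq_div_iff (mul_ne_zero hβ' hz')]
    linear_combination Real.sin β * h z

theorem extOp_isExtensionOp {β : ℝ} (hβ : Real.sin β ≠ 0) :
    e.IsExtensionOp β (extOp h0 (Real.cot β)) := by
  set t := Real.cot β with ht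
  have hβ' : (Real.sin β : ℂ) ≠ 0 := ofReal_ne_zero.2 hβ
  have key : ∀ (g f : e.Space) (w : ℂ), e.IsQuotient β w f g → ∀ z,
      (w • g + e.assoc t w • f) z = z * g z + f w * e.assoc t z := by
    intro g f w h z
    have h1 := ((isQuotient_iff hβ w f g).1 h).2 z
    rw [Space.add_apply, Space.smul_apply, Space.smul_apply]
    linear_combination -h1
  refine ⟨fun g => ⟨?_, ?_⟩, ?_⟩
  · rintro ⟨x, rfl⟩
    have ha : e.assoc t I ≠ 0 := e.assoc_ne_zero t (by simp)
    refine ⟨(e.assoc t I)⁻¹ • (extOp h0 t x - I • (x : e.Space)), I, ?_⟩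
    rw [isQuotient_iff hβ]
    refine ⟨(x : e.Space).mem.1, fun z => ?_⟩
    simp only [Space.smul_apply, Space.sub_apply, extOp_apply, ← ht]
    field_simp
    ring
  · rintro ⟨f, w, h⟩
    have h1 := (isQuotient_iff hβ w f g).1 h
    have hg := quotient_mem f.mem t w h1.1 h1.2
    exact ⟨⟨Space.mk g hg, mem_domain_extOp h0 t t (key (Space.mk g hg) f w h)⟩, rfl⟩
  · intro x f w h z
    rw [extOp_apply, coeff_eq h0 t (key x f w h), e.s_eq_sin_mul_assoc hβ, ← ht]
    field_simp

theorem exists_cot_eq (t : ℝ) : ∃ β ∈ Set.Ioo 0 Real.pi, Real.cot β = t := by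
  refine ⟨Real.pi / 2 - Real.arctan t, ⟨?_, ?_⟩, ?_⟩
  · linarith [Real.arctan_lt_pi_div_two t]
  · linarith [Real.neg_pi_div_two_lt_arctan t]
  · rw [Real.cot_eq_cos_div_sin, Real.cos_pi_div_two_sub, Real.sin_pi_div_two_sub,
      ← Real.tan_eq_sin_div_cos, Real.tan_arctan]

end HermiteBiehler

end

theorem mainTheorem1 (e : HermiteBiehler) (h0 : e.s 0 ∈ e.carrier) :
    ∃ S : ℝ → (e.Space →ₗ.[ℂ] e.Space),
      (∀ β ∈ Set.Ioo 0 Real.pi, e.IsExtensionOp β (S β)) ∧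
      {T : e.Space →ₗ.[ℂ] e.Space | e.mulOp ≤ T ∧ e.IsSelfadjointOp T} =
        S '' Set.Ioo 0 Real.pi ∧
      ∀ β ∈ Set.Ioo 0 Real.pi,
        (S β).domain = (S (Real.pi / 2)).domain ∧
        ∀ (x : (S β).domain) (y : (S (Real.pi / 2)).domain), (x : e.Space) = (y : e.Space) →
          S β x = S (Real.pi / 2) y -
            ((Real.cot β / Real.pi : ℝ) : ℂ) •
              (inner ℂ (HermiteBiehler.Space.mk (e.s 0) h0) (y : e.Space) •
                HermiteBiehler.Space.mk (e.s 0) h0) := by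
  refine ⟨fun β => HermiteBiehler.extOp h0 (Real.cot β), fun β hβ => ?_, ?_, fun β hβ => ⟨?_, ?_⟩⟩
  · exact HermiteBiehler.extOp_isExtensionOp h0 (Real.sin_pos_of_mem_Ioo hβ).ne'
  · ext T
    constructor
    · rintro ⟨hST, hT⟩
      obtain ⟨t, rfl⟩ := HermiteBiehler.exists_eq_extOp h0 hST hT
      obtain ⟨β, hβ, rfl⟩ := HermiteBiehler.exists_cot_eq t
      exact ⟨β, hβ, rfl⟩
    · rintro ⟨β, -, rfl⟩
      exact ⟨HermiteBiehler.mulOp_le_extOp h0 _, HermiteBiehler.extOp_isSelfadjointOp h0 _⟩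
  · exact HermiteBiehler.extOp_domain h0 _ _
  · intro x y hxy
    have hpi : (Real.pi : ℂ) ≠ 0 := ofReal_ne_zero.2 Real.pi_ne_zero
    have hcot : Real.cot (Real.pi / 2) = 0 := by
      rw [Real.cot_eq_cos_div_sin, Real.cos_pi_div_two, zero_div]
    ext z
    rw [HermiteBiehler.Space.sub_apply, HermiteBiehler.extOp_apply, HermiteBiehler.extOp_apply,
      HermiteBiehler.Space.smul_apply, HermiteBiehler.Space.smul_apply,
      HermiteBiehler.Space.mk_apply, HermiteBiehler.inner_s_zero_eq_coeff, hcot, hxy,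
      HermiteBiehler.assoc_eq_add, ofReal_div]
    field_simp
    ring
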